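/- Let $a,\varphi:\mathbb R^d\to[0,\infty)$ be bounded measurable functions such that $\int\varphi(x)\,dx<\infty$, $\int a(x)\,dx=1$ and $\int|x|^l a(x)\,dx<\infty$ for $l=1,\dots,d+1$. Let $\Gamma$ be the set of locally finite configurations $\gamma$ in $\mathbb R^d$ (multiple points allowed; all sums $\sum_{x\in\gamma}$ count multiplicities), with the smallest $\sigma$-field that makes all the maps $\gamma\mapsto|\gamma\cap\Lambda|$, $\Lambda$ compact, measurable. For $x\in\gamma$, $\gamma\setminus x$ is $\gamma$ with one copy of $x$ removed, and $\gamma\setminus x\cup y$ is obtained from it by adding one copy of $y$. For $\alpha\in(0,1]$ put $$\psi_\alpha(x)=\frac1{1+\alpha|x|^{d+1}},\qquad \Psi(\gamma)=\sum_{x\in\gamma}\psi_1(x),\qquad \Gamma_*=\{\gamma\in\Gamma:\Psi(\gamma)<\infty\},$$ $$c_\alpha(x,y;\gamma)=a(x-y)\,\psi_\alpha(x)\exp\Big(-\sum_{z\in\gamma\setminus x}\varphi(y-z)\Big),\qquad \Phi_\alpha(\gamma)=\sum_{x\in\gamma}\int_{\mathbb R^d}c_\alpha(x,y;\gamma)\,dy,$$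 $$\Omega_\alpha^\gamma(\mathbb A)=\sum_{x\in\gamma}\int_{\mathbb R^d}c_\alpha(x,y;\gamma)\,\mathbf 1_{\mathbb A}(\gamma\setminus x\cup y)\,dy.$$ Let $\mathcal M_*$ be the space of finite signed measures $\mu$ on $\Gamma$ with $|\mu|(\Gamma\setminus\Gamma_*)=0$, with the norm $\|\mu\|=|\mu|(\Gamma)$. For an integer $n\ge1$ let $\mathcal M_n$ be the space of finite signed measures $\mu$ on $\Gamma$ with $\|\mu\|_n:=\int(1+\Psi)^n\,d|\mu|<\infty$, normed by $\|\cdot\|_n$, and for $\beta>0$ let $\mathcal M_\beta$ be the space of those with $\int e^{\beta\Psi}\,d|\mu|<\infty$. All these spaces are contained in $\mathcal M_*$; a superscript $+$ denotes their subsets of nonnegative measures. For $\mu\in\mathcal M_1$ put $$L^{\dagger,\alpha}\mu=A\mu+B\mu,\qquad A\mu=-\Phi_\alpha\mu,\qquad (B\mu)(\mathbb A)=\int\Omega_\alpha^\gamma(\mathbb A)\,\mu(d\gamma).$$ A $C_0$-semigroup on $\mathcal M_*$ is called stochastic if its operators are positive and preserve the norm of nonnegative elements. Then for every $\alpha\in(0,1]$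 the operator $(L^{\dagger,\alpha},\mathcal M_1)$ is closable in $\mathcal M_*$ and its closure is the generator of a stochastic $C_0$-semigroup $S^\alpha=\{S^\alpha(t)\}_{t\ge0}$ on $\mathcal M_*$. For each integer $n\ge1$ one has $S^\alpha(t):\mathcal M_n\to\mathcal M_n$ for all $t\ge0$, and the restrictions $S^\alpha(t)|_{\mathcal M_n}$ form a $C_0$-semigroup on $\mathcal M_n$. Moreover, for all $\beta>0$ and $\beta'\in(0,\beta)$, $$S^\alpha(t):\mathcal M_\beta^+\to\mathcal M_{\beta'}^+\qquad\text{for } 0\le t<T_\alpha(\beta,\beta'):=\frac{\alpha(\beta-\beta')}{e^\beta+1}.$$ -/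

import Mathlib

open MeasureTheory Filter Topology Set
open scoped ENNReal NNReal

noncomputable section

namespace Kawasaki

/-! ### Strongly continuous semigroups -/

/-- A strongly continuous semigroup of bounded linear operators on a real normed space. -/
structure C0Semigroup (E : Type*) [NormedAddCommGroup E] [NormedSpace ℝ E] where
  op : ℝ≥0 → E →L[ℝ] E
  op_zero : op 0 = ContinuousLinearMap.id ℝ E
  op_add : ∀ s t, op (s + t) = (op s).comp (op t)
  tendsto_zero : ∀ x, Tendsto (fun t => op t x) (𝓝 0) (𝓝 x)

namespace C0Semigroup

variable {E : Type*} [NormedAddCommGroup E] [NormedSpace ℝ E]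

/-- The difference quotient `(S(t) x - x) / t`. -/
def quot (S : C0Semigroup E) (x : E) (t : ℝ≥0) : E := (t : ℝ)⁻¹ • (S.op t x - x)

/-- The set of those `x` for which `(S(t) x - x) / t` converges in norm as `t ↓ 0`. -/
def generatorDomain (S : C0Semigroup E) : Submodule ℝ E where
  carrier := {x | ∃ y, Tendsto (S.quot x) (𝓝[>] 0) (𝓝 y)}
  zero_mem' := ⟨0, by
    have : S.quot 0 = fun _ => 0 := by ext t; simp [quot]
    rw [this]; exact tendsto_const_nhds⟩
  add_mem' := by
    rintro x x' ⟨y, hy⟩ ⟨y', hy'⟩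
    refine ⟨y + y', (hy.add hy').congr fun t => ?_⟩
    simp only [quot, map_add, ← smul_add]
    congr 1; abel
  smul_mem' := by
    rintro c x ⟨y, hy⟩
    refine ⟨c • y, (hy.const_smul c).congr fun t => ?_⟩
    simp only [quot, map_smul, ← smul_sub]
    rw [smul_comm]

/-- The generator of a strongly continuous semigroup: `x ↦ lim_{t ↓ 0} (S(t) x - x) / t`. -/
def generator (S : C0Semigroup E) : E →ₗ.[ℝ] E where
  domain := S.generatorDomain
  toFun :=
    { toFun := fun x => x.2.choose
      map_add' := fun x x' => by
        have h := (x + x').2.choose_spec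
        refine tendsto_nhds_unique h ((x.2.choose_spec.add x'.2.choose_spec).congr fun t => ?_)
        simp only [quot, Submodule.coe_add, map_add, ← smul_add]
        congr 1; abel
      map_smul' := fun c x => by
        have h := (c • x).2.choose_spec
        refine tendsto_nhds_unique h ((x.2.choose_spec.const_smul c).congr fun t => ?_)
        simp only [quot, Submodule.coe_smul, map_smul, ← smul_sub]
        rw [smul_comm] }

end C0Semigroup

/-! ### Configurations -/

/-- The habitat `ℝ^d`. -/
abbrev Habitat (d : ℕ) := EuclideanSpace ℝ (Fin d)

/-- A locally finite configuration of points of `ℝ^d` (a finite or countable unordered system in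
which several points may have the same location), given by its multiplicities. -/
@[ext]
structure Config (d : ℕ) where
  mult : Habitat d → ℕ
  locallyFinite : ∀ K : Set (Habitat d), IsCompact K → {x ∈ K | mult x ≠ 0}.Finite

namespace Config

variable {d : ℕ}

/-- `∑_{x ∈ γ} f x`, counted with multiplicities. -/
def sum (γ : Config d) (f : Habitat d → ℝ≥0∞) : ℝ≥0∞ := ∑' x, (γ.mult x : ℝ≥0∞) * f x

/-- The number `N_Λ(γ) = |γ ∩ Λ|` of points of `γ` in `Λ`, counted with multiplicities. -/
def count (K : Set (Habitat d)) (γ : Config d) : ℝ≥0∞ := γ.sum (K.indicator 1)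

/-- The smallest `σ`-field that makes all the maps `N_Λ`, `Λ` compact, measurable. -/
instance : MeasurableSpace (Config d) :=
  ⨆ (K : Set (Habitat d)) (_ : IsCompact K), MeasurableSpace.comap (count K) inferInstance

/-- `γ ∖ x`: one copy of the point `x` is removed from `γ`. -/
def remove (γ : Config d) (x : Habitat d) : Config d where
  mult z := γ.mult z - ({x} : Set (Habitat d)).indicator 1 z
  locallyFinite K hK := (γ.locallyFinite K hK).subset fun z hz => ⟨hz.1, fun h => hz.2 (by simp [h])⟩

/-- `γ ∪ y`: one copy of the point `y` is added to `γ`. -/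
def add (γ : Config d) (y : Habitat d) : Config d where
  mult z := γ.mult z + ({y} : Set (Habitat d)).indicator 1 z
  locallyFinite K hK := by
    refine ((γ.locallyFinite K hK).union (finite_singleton y)).subset fun z hz => ?_
    by_cases h : z = y
    · exact Or.inr h
    · refine Or.inl ⟨hz.1, fun h0 => hz.2 ?_⟩
      simp [h0, h]

/-- `γ ∖ x ∪ y`. -/
def jump (γ : Config d) (x y : Habitat d) : Config d := (γ.remove x).add y

/-- The counting Radon measure `∑_{x ∈ γ} δ_x`. -/
def toMeasure (γ : Config d) : Measure (Habitat d) :=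
  Measure.sum fun x => (γ.mult x : ℝ≥0∞) • Measure.dirac x

theorem lintegral_toMeasure (γ : Config d) (f : Habitat d → ℝ≥0∞) :
    ∫⁻ x, f x ∂γ.toMeasure = γ.sum f := by
  simp [toMeasure, sum, lintegral_sum_measure, lintegral_smul_measure]

theorem toMeasure_apply (γ : Config d) {s : Set (Habitat d)} (hs : MeasurableSet s) :
    γ.toMeasure s = count s γ := by
  rw [← lintegral_indicator_one hs, lintegral_toMeasure]; rfl

theorem sum_add (γ : Config d) (y : Habitat d) (f : Habitat d → ℝ≥0∞) :
    (γ.add y).sum f = γ.sum f + f y := by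
  classical
  have : ∀ z, (((γ.add y).mult z : ℕ) : ℝ≥0∞) * f z
      = (γ.mult z : ℝ≥0∞) * f z + (if z = y then f y else 0) := by
    intro z
    by_cases h : z = y
    · subst h; simp [add, add_mul]
    · simp [add, h]
  simp only [sum, this]
  rw [ENNReal.tsum_add, tsum_ite_eq]

open Classical in
theorem sum_remove (γ : Config d) (x : Habitat d) (f : Habitat d → ℝ≥0∞) :
    (γ.remove x).sum f + (if γ.mult x = 0 then 0 else f x) = γ.sum f := by
  have : ∀ z, (γ.mult z : ℝ≥0∞) * f z = (((γ.remove x).mult z : ℕ) : ℝ≥0∞) * f z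
      + (if z = x then (if γ.mult x = 0 then 0 else f x) else 0) := by
    intro z
    by_cases h : z = x
    · subst h
      by_cases h0 : γ.mult z = 0
      · simp [remove, h0]
      · obtain ⟨k, hk⟩ := Nat.exists_eq_succ_of_ne_zero h0
        simp [remove, hk, add_mul]
    · simp [remove, h]
  simp only [sum, this]
  rw [ENNReal.tsum_add, tsum_ite_eq]

theorem measurable_count {K : Set (Habitat d)} (hK : IsCompact K) :
    Measurable (count K : Config d → ℝ≥0∞) := by
  rw [measurable_iff_comap_le]
  exact le_iSup₂_of_le K hK le_rfl

theorem measurable_of_count {P : Type*} [MeasurableSpace P] {c : P → Config d}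
    (h : ∀ K, IsCompact K → Measurable fun p => count K (c p)) : Measurable c := by
  rw [measurable_iff_comap_le]
  simp only [instMeasurableSpace, MeasurableSpace.comap_iSup, iSup_le_iff,
    MeasurableSpace.comap_comp]
  intro K hK
  exact measurable_iff_comap_le.1 (h K hK)

theorem count_lt_top (γ : Config d) {K : Set (Habitat d)} (hK : IsCompact K) :
    count K γ < ∞ := by
  have hf := γ.locallyFinite K hK
  have : count K γ = ∑ x ∈ hf.toFinset, (γ.mult x : ℝ≥0∞) * K.indicator 1 x := by
    refine tsum_eq_sum fun x hx => ?_
    by_cases hxK : x ∈ K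
    · have : γ.mult x = 0 := by
        by_contra h
        exact hx (by simpa using ⟨hxK, h⟩)
      simp [this]
    · simp [hxK]
  rw [this]
  refine ENNReal.sum_lt_top.2 fun x _ => ENNReal.mul_lt_top (by simp) ?_
  by_cases hxK : x ∈ K <;> simp [hxK]

theorem iUnion_ball : ⋃ n : ℕ, Metric.closedBall (0 : Habitat d) n = univ :=
  Metric.iUnion_closedBall_nat 0

/-- Sums over a configuration depend measurably on parameters. -/
theorem measurable_sum {P : Type*} [MeasurableSpace P] {c : P → Config d} (hc : Measurable c)
    {f : P → Habitat d → ℝ≥0∞} (hf : Measurable (Function.uncurry f)) :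
    Measurable fun p => (c p).sum (f p) := by
  set B : ℕ → Set (Habitat d) := fun n => Metric.closedBall 0 n with hB
  have hBc : ∀ n, IsCompact (B n) := fun n => isCompact_closedBall _ _
  have hBm : ∀ n, MeasurableSet (B n) := fun n => (hBc n).measurableSet
  have hfin : ∀ n p, IsFiniteMeasure ((c p).toMeasure.restrict (B n)) := fun n p =>
    ⟨by rw [Measure.restrict_apply_univ, toMeasure_apply _ (hBm n)]
        exact count_lt_top _ (hBc n)⟩
  have h1 : ∀ n, Measurable fun p => (c p).toMeasure.restrict (B n) := by
    intro n
    have := hfin n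
    have key : ∀ s : Set (Habitat d), IsClosed s →
        Measurable fun p => ((c p).toMeasure.restrict (B n)) s := by
      intro s hs
      have : (fun p => ((c p).toMeasure.restrict (B n)) s) = fun p => count (s ∩ B n) (c p) := by
        ext p
        rw [Measure.restrict_apply hs.measurableSet,
          toMeasure_apply _ (hs.measurableSet.inter (hBm n))]
      rw [this]
      exact (measurable_count ((hBc n).inter_left hs)).comp hc
    refine Measurable.measure_of_isPiSystem (S := {s | IsClosed s}) ?_ isPiSystem_isClosed
      (fun s hs => key s hs) (key _ isClosed_univ)
    rw [BorelSpace.measurable_eq (α := Habitat d), borel_eq_generateFrom_isClosed]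
  have h2 : ∀ n, Measurable fun p => ∫⁻ x in B n, f p x ∂(c p).toMeasure := by
    intro n
    have := hfin n
    have hm : Measurable fun p => ((c p).toMeasure.restrict (B n)).map (Prod.mk p) := by
      have hfin' : ∀ p, IsFiniteMeasure (((c p).toMeasure.restrict (B n)).map (Prod.mk p)) :=
        fun p => Measure.isFiniteMeasure_map _ _
      have key : ∀ (s : Set P) (t : Set (Habitat d)), MeasurableSet s → MeasurableSet t →
          Measurable fun p => (((c p).toMeasure.restrict (B n)).map (Prod.mk p)) (s ×ˢ t) := by
        intro s t hs ht
        have : (fun p => (((c p).toMeasure.restrict (B n)).map (Prod.mk p)) (s ×ˢ t))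
            = s.indicator fun p => ((c p).toMeasure.restrict (B n)) t := by
          ext p
          rw [Measure.map_apply measurable_prodMk_left (hs.prod ht)]
          by_cases hp : p ∈ s
          · simp [hp]
          · simp [hp]
        rw [this]
        exact ((Measure.measurable_coe ht).comp (h1 n)).indicator hs
      refine Measurable.measure_of_isPiSystem generateFrom_prod.symm isPiSystem_prod ?_ ?_
      · rintro _ ⟨s, hs, t, ht, rfl⟩
        exact key s t hs ht
      · rw [← univ_prod_univ]
        exact key _ _ MeasurableSet.univ MeasurableSet.univ
    have : (fun p => ∫⁻ x in B n, f p x ∂(c p).toMeasure)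
        = fun p => ∫⁻ q, Function.uncurry f q
            ∂(((c p).toMeasure.restrict (B n)).map (Prod.mk p)) := by
      ext p
      rw [lintegral_map hf measurable_prodMk_left]
      rfl
    rw [this]
    exact (Measure.measurable_lintegral hf).comp hm
  have h3 : (fun p => (c p).sum (f p)) = fun p => ⨆ n, ∫⁻ x in B n, f p x ∂(c p).toMeasure := by
    ext p
    rw [← lintegral_toMeasure, ← setLIntegral_univ, ← iUnion_ball, setLIntegral_iUnion_of_directed]
    refine directed_of_isDirected_le fun m n hmn => ?_
    exact Metric.closedBall_subset_closedBall (by exact_mod_cast hmn)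
  rw [h3]
  exact Measurable.iSup h2

theorem measurableSet_mult_eq_zero {P : Type*} [MeasurableSpace P] {c : P → Config d}
    (hc : Measurable c) {g : P → Habitat d} (hg : Measurable g) :
    MeasurableSet {p | (c p).mult (g p) = 0} := by
  classical
  have h : Measurable fun p => (c p).sum (fun z => if z = g p then 1 else 0) := by
    refine measurable_sum hc (f := fun p z => if z = g p then 1 else 0) ?_
    exact Measurable.ite (measurableSet_eq_fun measurable_snd (hg.comp measurable_fst))
      measurable_const measurable_const
  have h' : ∀ p, (c p).sum (fun z => if z = g p then 1 else 0) = ((c p).mult (g p) : ℝ≥0∞) := by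
    intro p
    simp only [sum, mul_ite, mul_one, mul_zero]
    rw [tsum_eq_single (g p) (fun z hz => by simp [hz])]
    simp
  simp only [h'] at h
  have : {p | (c p).mult (g p) = 0} = (fun p => ((c p).mult (g p) : ℝ≥0∞)) ⁻¹' {0} := by
    ext p; simp
  rw [this]
  exact h (measurableSet_singleton 0)

theorem measurable_remove {P : Type*} [MeasurableSpace P] {c : P → Config d} (hc : Measurable c)
    {g : P → Habitat d} (hg : Measurable g) : Measurable fun p => (c p).remove (g p) := by
  classical
  refine measurable_of_count fun K hK => ?_
  have hm : Measurable fun p => if (c p).mult (g p) = 0 then 0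
      else K.indicator (1 : Habitat d → ℝ≥0∞) (g p) :=
    Measurable.ite (measurableSet_mult_eq_zero hc hg) measurable_const
      ((measurable_one.indicator hK.measurableSet).comp hg)
  have : (fun p => count K ((c p).remove (g p))) = fun p => count K (c p) -
      (if (c p).mult (g p) = 0 then 0 else K.indicator (1 : Habitat d → ℝ≥0∞) (g p)) := by
    ext p
    rw [count, count, ← sum_remove (c p) (g p), ENNReal.add_sub_cancel_right]
    split_ifs
    · simp
    · by_cases hx : g p ∈ K <;> simp [hx]
  rw [this]
  exact ((measurable_count hK).comp hc).sub hm

theorem measurable_add {P : Type*} [MeasurableSpace P] {c : P → Config d} (hc : Measurable c)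
    {g : P → Habitat d} (hg : Measurable g) : Measurable fun p => (c p).add (g p) := by
  refine measurable_of_count fun K hK => ?_
  simp only [count, sum_add]
  exact ((measurable_count hK).comp hc).add
    ((measurable_one.indicator hK.measurableSet).comp hg)

theorem measurable_jump {P : Type*} [MeasurableSpace P] {c : P → Config d} (hc : Measurable c)
    {g g' : P → Habitat d} (hg : Measurable g) (hg' : Measurable g') :
    Measurable fun p => (c p).jump (g p) (g' p) :=
  measurable_add (measurable_remove hc hg) hg'

end Config

/-! ### Tempered configurations -/

variable {d : ℕ}

/-- `ψ_α(x) = 1 / (1 + α |x|^{d+1})`; `ψ = ψ_1`. -/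
def psi (α : ℝ) (x : Habitat d) : ℝ := 1 / (1 + α * ‖x‖ ^ (d + 1))

/-- `Ψ(γ) = ∑_{x ∈ γ} ψ(x)`. -/
def Psi (γ : Config d) : ℝ≥0∞ := γ.sum fun x => ENNReal.ofReal (psi 1 x)

variable (d) in
/-- The set `Γ_*` of tempered configurations. -/
def tempered : Set (Config d) := {γ | Psi γ < ∞}

theorem measurable_psi (α : ℝ) : Measurable (psi α : Habitat d → ℝ) := by
  unfold psi; fun_prop

theorem measurable_Psi : Measurable (Psi : Config d → ℝ≥0∞) :=
  Config.measurable_sum measurable_id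
    (f := fun _ x => ENNReal.ofReal (psi 1 x))
    (((measurable_psi 1).comp measurable_snd).ennreal_ofReal)

theorem measurableSet_tempered : MeasurableSet (tempered d) :=
  measurableSet_lt measurable_Psi measurable_const

/-! ### The model -/

/-- The standing assumptions on the jump kernel `a` and the repulsion potential `φ`. -/
structure ModelAssumptions (a φ : Habitat d → ℝ) : Prop where
  a_measurable : Measurable a
  φ_measurable : Measurable φ
  a_nonneg : ∀ x, 0 ≤ a x
  φ_nonneg : ∀ x, 0 ≤ φ x
  a_bounded : BddAbove (range a)
  φ_bounded : BddAbove (range φ)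
  φ_integrable : Integrable φ
  a_integrable : Integrable a
  a_integral : ∫ x, a x = 1
  a_moments : ∀ l ∈ Finset.Icc 1 (d + 1), Integrable fun x => ‖x‖ ^ l * a x

/-- `a_α(x,y) exp(-∑_{z ∈ γ∖x} φ(y - z))` with `a_α(x,y) = a(x - y) ψ_α(x)`; the sum may be
infinite, in which case the exponential is zero. -/
def rate (a φ : Habitat d → ℝ) (α : ℝ) (γ : Config d) (x y : Habitat d) : ℝ≥0∞ :=
  ENNReal.ofReal (a (x - y) * psi α x) *
    EReal.exp (-(((γ.remove x).sum fun z => ENNReal.ofReal (φ (y - z)) : ℝ≥0∞) : EReal))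

/-- `Φ_α(γ) = ∑_{x ∈ γ} ∫ a_α(x,y) exp(-∑_{z ∈ γ∖x} φ(y - z)) dy`. -/
def Phi (a φ : Habitat d → ℝ) (α : ℝ) (γ : Config d) : ℝ≥0∞ :=
  γ.sum fun x => ∫⁻ y, rate a φ α γ x y

/-- The measure kernel
`Ω_α^γ(𝔸) = ∑_{x ∈ γ} ∫ a_α(x,y) exp(-∑_{z ∈ γ∖x} φ(y - z)) 𝟙_𝔸(γ∖x∪y) dy`. -/
def Omega (a φ : Habitat d → ℝ) (α : ℝ) (γ : Config d) : Measure (Config d) :=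
  Measure.sum fun x =>
    (γ.mult x : ℝ≥0∞) • ((volume.withDensity (rate a φ α γ x)).map (γ.jump x))

theorem measurable_rate {a φ : Habitat d → ℝ} (h : ModelAssumptions a φ) (α : ℝ)
    {P : Type*} [MeasurableSpace P] {c : P → Config d} (hc : Measurable c)
    {g g' : P → Habitat d} (hg : Measurable g) (hg' : Measurable g') :
    Measurable fun p => rate a φ α (c p) (g p) (g' p) := by
  refine Measurable.mul ?_ ?_
  · exact ((h.a_measurable.comp (hg.sub hg')).mul ((measurable_psi α).comp hg)).ennreal_ofReal
  · refine EReal.measurable_exp.comp (Measurable.neg (Measurable.coe_ereal_ennreal ?_))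
    refine Config.measurable_sum (Config.measurable_remove hc hg)
      (f := fun p z => ENNReal.ofReal (φ (g' p - z))) ?_
    exact (h.φ_measurable.comp ((hg'.comp measurable_fst).sub measurable_snd)).ennreal_ofReal

theorem measurable_Phi {a φ : Habitat d → ℝ} (h : ModelAssumptions a φ) (α : ℝ) :
    Measurable (Phi a φ α) := by
  refine Config.measurable_sum measurable_id (f := fun γ x => ∫⁻ y, rate a φ α γ x y) ?_
  exact Measurable.lintegral_prod_right' (f := fun q : (Config d × Habitat d) × Habitat d =>
    rate a φ α q.1.1 q.1.2 q.2) (measurable_rate h α (by fun_prop) (by fun_prop) (by fun_prop))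

theorem Omega_apply {a φ : Habitat d → ℝ} (h : ModelAssumptions a φ) (α : ℝ) (γ : Config d)
    {A : Set (Config d)} (hA : MeasurableSet A) :
    Omega a φ α γ A =
      γ.sum fun x => ∫⁻ y, rate a φ α γ x y * A.indicator 1 (γ.jump x y) := by
  rw [Omega, Measure.sum_apply _ hA, Config.sum]
  refine tsum_congr fun x => ?_
  have hj : Measurable (γ.jump x) :=
    Config.measurable_jump measurable_const measurable_const measurable_id
  have hr : Measurable (rate a φ α γ x) :=
    measurable_rate h α measurable_const measurable_const measurable_id
  rw [Measure.smul_apply, smul_eq_mul, Measure.map_apply hj hA, withDensity_apply _ (hj hA),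
    ← lintegral_indicator (hj hA)]
  congr 2
  ext y
  by_cases hy : γ.jump x y ∈ A <;> simp [hy]

theorem Omega_univ {a φ : Habitat d → ℝ} (h : ModelAssumptions a φ) (α : ℝ) (γ : Config d) :
    Omega a φ α γ univ = Phi a φ α γ := by
  rw [Omega_apply h α γ MeasurableSet.univ, Phi]; simp

theorem measurable_Omega {a φ : Habitat d → ℝ} (h : ModelAssumptions a φ) (α : ℝ) :
    Measurable (Omega a φ α) := by
  refine Measure.measurable_of_measurable_coe _ fun A hA => ?_
  simp only [Omega_apply h α _ hA]
  refine Config.measurable_sum measurable_id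
    (f := fun γ x => ∫⁻ y, rate a φ α γ x y * A.indicator 1 (γ.jump x y)) ?_
  refine Measurable.lintegral_prod_right' (f := fun q : (Config d × Habitat d) × Habitat d =>
    rate a φ α q.1.1 q.1.2 q.2 * A.indicator 1 (q.1.1.jump q.1.2 q.2)) ?_
  exact (measurable_rate h α (by fun_prop) (by fun_prop) (by fun_prop)).mul
    ((measurable_one.indicator hA).comp
      (Config.measurable_jump (by fun_prop) (by fun_prop) (by fun_prop)))

theorem psi_nonneg {α : ℝ} (hα : 0 ≤ α) (x : Habitat d) : 0 ≤ psi α x := by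
  unfold psi; positivity

theorem psi_le {α : ℝ} (hα : α ∈ Ioc (0 : ℝ) 1) (x : Habitat d) : psi α x ≤ α⁻¹ * psi 1 x := by
  have h0 := hα.1
  have h1 := hα.2
  have hx : 0 ≤ ‖x‖ ^ (d + 1) := by positivity
  unfold psi
  rw [inv_mul_eq_div, div_div, div_le_div_iff₀ (by positivity) (by positivity)]
  nlinarith

theorem Phi_le {a φ : Habitat d → ℝ} (h : ModelAssumptions a φ) {α : ℝ}
    (hα : α ∈ Ioc (0 : ℝ) 1) (γ : Config d) :
    Phi a φ α γ ≤ ENNReal.ofReal α⁻¹ * Psi γ := by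
  rw [Phi, Psi, Config.sum, Config.sum, ← ENNReal.tsum_mul_left]
  refine ENNReal.tsum_le_tsum fun x => ?_
  rw [mul_left_comm, ← ENNReal.ofReal_mul (inv_nonneg.2 hα.1.le)]
  gcongr
  have ha : ∫⁻ y, ENNReal.ofReal (a (x - y)) = 1 := by
    rw [lintegral_sub_left_eq_self (fun y => ENNReal.ofReal (a y)) x,
      ← ofReal_integral_eq_lintegral_ofReal h.a_integrable (ae_of_all _ h.a_nonneg),
      h.a_integral, ENNReal.ofReal_one]
  calc ∫⁻ y, rate a φ α γ x y
      ≤ ∫⁻ y, ENNReal.ofReal (a (x - y)) * ENNReal.ofReal (psi α x) := by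
        refine lintegral_mono fun y => ?_
        rw [rate, ENNReal.ofReal_mul (h.a_nonneg _)]
        refine mul_le_of_le_one_right' ?_
        rw [← EReal.exp_zero, EReal.exp_le_exp_iff, EReal.neg_le_zero]
        exact EReal.coe_ennreal_nonneg _
    _ = ENNReal.ofReal (psi α x) := by
        rw [lintegral_mul_const' _ _ ENNReal.ofReal_ne_top, ha, one_mul]
    _ ≤ _ := ENNReal.ofReal_le_ofReal (psi_le hα x)

theorem jump_mem_tempered {γ : Config d} (hγ : γ ∈ tempered d) (x y : Habitat d) :
    γ.jump x y ∈ tempered d := by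
  classical
  change Psi (γ.jump x y) < ∞
  rw [Psi, Config.jump, Config.sum_add]
  refine ENNReal.add_lt_top.2 ⟨lt_of_le_of_lt ?_ (show Psi γ < ∞ from hγ), ENNReal.ofReal_lt_top⟩
  rw [Psi, ← Config.sum_remove γ x]
  exact le_self_add

theorem Omega_compl_tempered {a φ : Habitat d → ℝ} (h : ModelAssumptions a φ) (α : ℝ)
    {γ : Config d} (hγ : γ ∈ tempered d) : Omega a φ α γ (tempered d)ᶜ = 0 := by
  rw [Omega_apply h α γ measurableSet_tempered.compl]
  simp [Config.sum, jump_mem_tempered hγ]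

/-! ### Signed measures -/

section Signed

variable {X : Type*} [MeasurableSpace X]

theorem totalVariation_add_le (μ ν : SignedMeasure X) :
    (μ + ν).totalVariation ≤ μ.totalVariation + ν.totalVariation := by
  simp only [SignedMeasure.totalVariation_eq_variation]
  exact VectorMeasure.variation_add_le

theorem totalVariation_smul (c : ℝ) (μ : SignedMeasure X) :
    (c • μ).totalVariation = ‖c‖ₑ • μ.totalVariation := by
  simp only [SignedMeasure.totalVariation_eq_variation]
  rw [VectorMeasure.variation_smul]
  rfl

/-- A finite positive measure as a signed measure. -/
def toSigned (m : Measure X) : SignedMeasure X := by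
  classical exact if h : IsFiniteMeasure m then m.toSignedMeasure else 0

theorem toSigned_eq (m : Measure X) [h : IsFiniteMeasure m] : toSigned m = m.toSignedMeasure := by
  simp [toSigned, h]

/-- The extension `μ ↦ T μ⁺ - T μ⁻` to signed measures of a map `T` of positive measures, where
`μ = μ⁺ - μ⁻` is the Jordan decomposition. -/
def signedExt (T : Measure X → Measure X) (μ : SignedMeasure X) : SignedMeasure X :=
  toSigned (T μ.toJordanDecomposition.posPart) - toSigned (T μ.toJordanDecomposition.negPart)

/-- `∫ w d|μ|`. -/
def absIntegral (w : X → ℝ≥0∞) (μ : SignedMeasure X) : ℝ≥0∞ := ∫⁻ x, w x ∂μ.totalVariation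

/-- The space of all those finite signed measures `μ` for which `w μ` is a finite signed
measure. -/
def weighted (w : X → ℝ≥0∞) : Submodule ℝ (SignedMeasure X) where
  carrier := {μ | absIntegral w μ < ∞}
  zero_mem' := by simp [absIntegral, SignedMeasure.totalVariation_zero]
  add_mem' := by
    intro μ ν hμ hν
    refine lt_of_le_of_lt (lintegral_mono' (totalVariation_add_le μ ν) le_rfl) ?_
    rw [lintegral_add_measure]
    exact ENNReal.add_lt_top.2 ⟨hμ, hν⟩
  smul_mem' := by
    intro c μ hμ
    change ∫⁻ x, w x ∂(c • μ).totalVariation < ∞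
    rw [totalVariation_smul, lintegral_smul_measure]
    exact ENNReal.mul_lt_top (by simp) hμ

/-- `μ ↦ ∫ w d|μ|` satisfies the axioms of a norm when `w ≥ 1`. -/
theorem weightedCore {w : X → ℝ≥0∞} (hw : ∀ x, 1 ≤ w x) (V : Submodule ℝ (SignedMeasure X))
    (hV : ∀ μ ∈ V, absIntegral w μ < ∞) :
    letI : Norm V := ⟨fun μ => (absIntegral w μ).toReal⟩
    NormedSpace.Core ℝ V :=
  letI : Norm V := ⟨fun μ => (absIntegral w μ).toReal⟩
  { norm_nonneg := fun _ => ENNReal.toReal_nonneg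
    norm_smul := fun c μ => by
      change (∫⁻ x, w x ∂(c • (μ : SignedMeasure X)).totalVariation).toReal
        = ‖c‖ * (∫⁻ x, w x ∂(μ : SignedMeasure X).totalVariation).toReal
      rw [totalVariation_smul, lintegral_smul_measure, smul_eq_mul, ENNReal.toReal_mul,
        toReal_enorm]
    norm_triangle := fun μ ν => by
      change (∫⁻ x, w x ∂((μ : SignedMeasure X) + ν).totalVariation).toReal ≤ _
      have hμ := hV μ μ.2
      have hν := hV ν ν.2
      change _ ≤ (absIntegral w (μ : SignedMeasure X)).toReal
        + (absIntegral w (ν : SignedMeasure X)).toReal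
      rw [← ENNReal.toReal_add hμ.ne hν.ne]
      refine ENNReal.toReal_mono (ENNReal.add_lt_top.2 ⟨hμ, hν⟩).ne ?_
      refine (lintegral_mono' (totalVariation_add_le _ _) le_rfl).trans_eq ?_
      rw [lintegral_add_measure]; rfl
    norm_eq_zero_iff := fun μ => by
      change (absIntegral w (μ : SignedMeasure X)).toReal = 0 ↔ _
      constructor
      · intro h0
        have h1 : absIntegral w (μ : SignedMeasure X) = 0 :=
          ((ENNReal.toReal_eq_zero_iff _).1 h0).resolve_right (hV μ μ.2).ne
        have h2 : (μ : SignedMeasure X).totalVariation univ = 0 := by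
          refine le_antisymm ?_ bot_le
          rw [← h1, absIntegral, ← lintegral_one]
          exact lintegral_mono hw
        rw [SignedMeasure.totalVariation_eq_variation, Measure.measure_univ_eq_zero,
          VectorMeasure.variation_eq_zero] at h2
        exact Subtype.ext h2
      · rintro rfl
        simp [absIntegral, SignedMeasure.totalVariation_zero] }

end Signed

/-! ### The Banach spaces of measures -/

variable (d) in
/-- The space `M_*` of finite signed measures on `Γ` with `|μ|(Γ_*^c) = 0`. -/
def MStar : Submodule ℝ (SignedMeasure (Config d)) where
  carrier := {μ | μ.totalVariation (tempered d)ᶜ = 0}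
  zero_mem' := by simp [SignedMeasure.totalVariation_zero]
  add_mem' := by
    intro μ ν hμ hν
    refine le_antisymm ((totalVariation_add_le μ ν _).trans ?_) bot_le
    rw [Measure.add_apply, hμ, hν, add_zero]
  smul_mem' := by
    intro c μ hμ
    change (c • μ).totalVariation _ = 0
    rw [totalVariation_smul, Measure.smul_apply, hμ, smul_zero]

variable (d) in
/-- The space `M_n` of those `μ` for which `Ψ_1^n μ` is a finite signed measure, where
`Ψ_1 = 1 + Ψ`. -/
def Mn (n : ℕ) : Submodule ℝ (SignedMeasure (Config d)) := weighted fun γ => (1 + Psi γ) ^ n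

variable (d) in
/-- The space `M_β` of those `μ` for which `exp(β Ψ) μ` is a finite signed measure. -/
def Mbeta (β : ℝ) : Submodule ℝ (SignedMeasure (Config d)) :=
  weighted fun γ => EReal.exp ((ENNReal.ofReal β * Psi γ : ℝ≥0∞) : EReal)

theorem MStar_finite (μ : SignedMeasure (Config d)) : absIntegral (fun _ => 1) μ < ∞ := by
  simp [absIntegral]

/-- The norm `‖μ‖ = |μ|(Γ)` on `M_*`. -/
instance : Norm (MStar d) :=
  ⟨fun μ => (absIntegral (fun _ => 1) (μ : SignedMeasure (Config d))).toReal⟩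

theorem MStar_norm (μ : MStar d) :
    ‖μ‖ = ((μ : SignedMeasure (Config d)).totalVariation univ).toReal := by
  change (∫⁻ _, 1 ∂(μ : SignedMeasure (Config d)).totalVariation).toReal = _
  rw [lintegral_one]

theorem MStar_core : NormedSpace.Core ℝ (MStar d) :=
  weightedCore (fun _ => le_rfl) (MStar d) fun μ _ => MStar_finite μ

instance : NormedAddCommGroup (MStar d) := NormedAddCommGroup.ofCore MStar_core

instance : NormedSpace ℝ (MStar d) := NormedSpace.ofCore MStar_core

/-- The norm `‖μ‖_n = ∫ Ψ_1^n d|μ|` on `M_n`. -/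
instance (n : ℕ) : Norm (Mn d n) :=
  ⟨fun μ => (absIntegral (fun γ => (1 + Psi γ) ^ n) (μ : SignedMeasure (Config d))).toReal⟩

theorem Mn_core (n : ℕ) : NormedSpace.Core ℝ (Mn d n) :=
  weightedCore (fun _ => one_le_pow₀ le_self_add) (Mn d n) fun _ hμ => hμ

instance (n : ℕ) : NormedAddCommGroup (Mn d n) := NormedAddCommGroup.ofCore (Mn_core n)

instance (n : ℕ) : NormedSpace ℝ (Mn d n) := NormedSpace.ofCore (Mn_core n)

theorem Mn_le_MStar {n : ℕ} (hn : 1 ≤ n) : Mn d n ≤ MStar d := by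
  intro μ hμ
  have h := ae_lt_top ((measurable_const.add measurable_Psi).pow_const n)
    (show absIntegral (fun γ => (1 + Psi γ) ^ n) μ < ∞ from hμ).ne
  refine measure_mono_null ?_ h
  intro γ hγ hlt
  refine hγ (?_ : Psi γ < ∞)
  have h1 : 1 + Psi γ < ∞ := by
    by_contra hc
    have : 1 + Psi γ = ∞ := by simpa using hc
    change (1 + Psi γ) ^ n < ∞ at hlt
    simp [this, Nat.one_le_iff_ne_zero.1 hn] at hlt
  exact lt_of_le_of_lt le_add_self h1

/-- The embedding of `M_n` into `M_*`. -/
def inclMn {n : ℕ} (hn : 1 ≤ n) (μ : Mn d n) : MStar d := ⟨μ, Mn_le_MStar hn μ.2⟩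

theorem Mbeta_le_MStar {β : ℝ} (hβ : 0 < β) : Mbeta d β ≤ MStar d := by
  intro μ hμ
  have h := ae_lt_top (EReal.measurable_exp.comp
    (measurable_Psi.const_mul (ENNReal.ofReal β)).coe_ereal_ennreal)
    (show absIntegral _ μ < ∞ from hμ).ne
  refine measure_mono_null ?_ h
  intro γ hγ hlt
  have h1 : Psi γ = ∞ := by simpa [tempered] using hγ
  change EReal.exp ((ENNReal.ofReal β * Psi γ : ℝ≥0∞) : EReal) < ∞ at hlt
  rw [h1, ENNReal.mul_top (by simpa using hβ)] at hlt
  simp at hlt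

/-! ### The operator -/

/-- The multiplication operator by `-Φ_α`. -/
def opA (a φ : Habitat d → ℝ) (α : ℝ) (μ : SignedMeasure (Config d)) :
    SignedMeasure (Config d) :=
  -signedExt (fun m => m.withDensity (Phi a φ α)) μ

/-- `(B μ)(𝔸) = ∫ Ω_α^γ(𝔸) μ(dγ)`. -/
def opB (a φ : Habitat d → ℝ) (α : ℝ) (μ : SignedMeasure (Config d)) :
    SignedMeasure (Config d) :=
  signedExt (fun m => m.bind (Omega a φ α)) μ

theorem signedExt_neg {X : Type*} [MeasurableSpace X] (T : Measure X → Measure X)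
    (μ : SignedMeasure X) : signedExt T (-μ) = -signedExt T μ := by
  simp [signedExt, SignedMeasure.toJordanDecomposition_neg]

theorem toSigned_add {X : Type*} [MeasurableSpace X] (m m' : Measure X) [IsFiniteMeasure m]
    [IsFiniteMeasure m'] : toSigned (m + m') = toSigned m + toSigned m' := by
  simp only [toSigned_eq, Measure.toSignedMeasure_add]

/-- The facts about a map of positive measures under which its signed extension is linear on
`V`. -/
structure IsPositiveLinearOn {X : Type*} [MeasurableSpace X] (T : Measure X → Measure X)
    (V : Submodule ℝ (SignedMeasure X)) : Prop where
  add : ∀ m m', T (m + m') = T m + T m'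
  smul : ∀ (c : ℝ≥0) m, T (c • m) = c • T m
  finite : ∀ μ ∈ V, IsFiniteMeasure (T μ.totalVariation)

namespace IsPositiveLinearOn

variable {X : Type*} [MeasurableSpace X] {T : Measure X → Measure X}
  {V : Submodule ℝ (SignedMeasure X)}

theorem finite_posPart (hT : IsPositiveLinearOn T V) {μ : SignedMeasure X} (hμ : μ ∈ V) :
    IsFiniteMeasure (T μ.toJordanDecomposition.posPart) := by
  have := hT.finite μ hμ
  rw [SignedMeasure.totalVariation, hT.add] at this
  exact isFiniteMeasure_of_le _
    (Measure.le_add_right (ν' := T μ.toJordanDecomposition.negPart) le_rfl)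

theorem finite_negPart (hT : IsPositiveLinearOn T V) {μ : SignedMeasure X} (hμ : μ ∈ V) :
    IsFiniteMeasure (T μ.toJordanDecomposition.negPart) := by
  have := hT.finite μ hμ
  rw [SignedMeasure.totalVariation, hT.add] at this
  exact isFiniteMeasure_of_le _
    (Measure.le_add_left (ν' := T μ.toJordanDecomposition.posPart) le_rfl)

theorem map_add (hT : IsPositiveLinearOn T V) {μ ν : SignedMeasure X} (hμ : μ ∈ V) (hν : ν ∈ V) :
    signedExt T (μ + ν) = signedExt T μ + signedExt T ν := by
  have h1 := hT.finite_posPart hμ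
  have h2 := hT.finite_negPart hμ
  have h3 := hT.finite_posPart hν
  have h4 := hT.finite_negPart hν
  have h5 := hT.finite_posPart (V.add_mem hμ hν)
  have h6 := hT.finite_negPart (V.add_mem hμ hν)
  have e : (μ + ν).toJordanDecomposition.posPart
      + (μ.toJordanDecomposition.negPart + ν.toJordanDecomposition.negPart)
      = (μ + ν).toJordanDecomposition.negPart
      + (μ.toJordanDecomposition.posPart + ν.toJordanDecomposition.posPart) := by
    rw [← Measure.toSignedMeasure_eq_toSignedMeasure_iff]
    simp only [Measure.toSignedMeasure_add]
    have a1 := SignedMeasure.toSignedMeasure_toJordanDecomposition μ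
    have a2 := SignedMeasure.toSignedMeasure_toJordanDecomposition ν
    have a3 := SignedMeasure.toSignedMeasure_toJordanDecomposition (μ + ν)
    rw [JordanDecomposition.toSignedMeasure, sub_eq_iff_eq_add] at a1 a2 a3
    rw [a1, a2, a3]
    nth_rewrite 1 [show μ + ν = (μ + ν : SignedMeasure X) from rfl]
    abel
  have e' := congrArg (fun m => toSigned (T m)) e
  simp only [hT.add, toSigned_add] at e'
  simp only [signedExt]
  rw [← sub_eq_zero] at e' ⊢
  rw [← e']
  abel

theorem map_nnreal_smul (hT : IsPositiveLinearOn T V) (c : ℝ≥0) {μ : SignedMeasure X} (hμ : μ ∈ V) :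
    signedExt T (c • μ) = c • signedExt T μ := by
  have h1 := hT.finite_posPart hμ
  have h2 := hT.finite_negPart hμ
  simp only [signedExt, SignedMeasure.toJordanDecomposition_smul,
    JordanDecomposition.smul_posPart, JordanDecomposition.smul_negPart, hT.smul, toSigned_eq,
    Measure.toSignedMeasure_smul, smul_sub]

theorem map_smul (hT : IsPositiveLinearOn T V) (c : ℝ) {μ : SignedMeasure X} (hμ : μ ∈ V) :
    signedExt T (c • μ) = c • signedExt T μ := by
  rcases le_total 0 c with hc | hc
  · exact hT.map_nnreal_smul ⟨c, hc⟩ hμ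
  · have h := hT.map_nnreal_smul ⟨-c, neg_nonneg.2 hc⟩ hμ
    have h' : signedExt T ((-c) • μ) = (-c) • signedExt T μ := h
    have e : ∀ ν : SignedMeasure X, (-c) • ν = -(c • ν) := fun ν => by ext; simp
    rwa [e, e, signedExt_neg, neg_inj] at h'

theorem totalVariation_signedExt_le (T : Measure X → Measure X) (μ : SignedMeasure X) :
    (signedExt T μ).totalVariation ≤ T μ.toJordanDecomposition.posPart
      + T μ.toJordanDecomposition.negPart := by
  have key : ∀ m : Measure X, (toSigned m).variation ≤ m := by
    intro m
    by_cases h : IsFiniteMeasure m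
    · rw [toSigned_eq, Measure.variation_toSignedMeasure]
    · simp only [toSigned, h, dite_false, VectorMeasure.variation_zero]
      exact bot_le
  rw [SignedMeasure.totalVariation_eq_variation, signedExt]
  exact VectorMeasure.variation_sub_le.trans (add_le_add (key _) (key _))

end IsPositiveLinearOn

theorem absIntegral_Phi_lt_top {a φ : Habitat d → ℝ} (h : ModelAssumptions a φ) {α : ℝ}
    (hα : α ∈ Ioc (0 : ℝ) 1) {μ : SignedMeasure (Config d)} (hμ : μ ∈ Mn d 1) :
    absIntegral (Phi a φ α) μ < ∞ := by
  calc absIntegral (Phi a φ α) μ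
      ≤ ∫⁻ γ, ENNReal.ofReal α⁻¹ * (1 + Psi γ) ^ 1 ∂μ.totalVariation := by
        refine lintegral_mono fun γ => (Phi_le h hα γ).trans ?_
        rw [pow_one]
        gcongr
        exact le_add_self
    _ = ENNReal.ofReal α⁻¹ * absIntegral (fun γ => (1 + Psi γ) ^ 1) μ :=
        lintegral_const_mul' _ _ ENNReal.ofReal_ne_top
    _ < ∞ := ENNReal.mul_lt_top ENNReal.ofReal_lt_top hμ

theorem isPositiveLinearOn_withDensity {a φ : Habitat d → ℝ} (h : ModelAssumptions a φ) {α : ℝ}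
    (hα : α ∈ Ioc (0 : ℝ) 1) :
    IsPositiveLinearOn (fun m => m.withDensity (Phi a φ α)) (Mn d 1) where
  add _ _ := withDensity_add_measure _ _ _
  smul _ _ := withDensity_smul_measure _ _
  finite _ hμ := isFiniteMeasure_withDensity (absIntegral_Phi_lt_top h hα hμ).ne

theorem isPositiveLinearOn_bind {a φ : Habitat d → ℝ} (h : ModelAssumptions a φ) {α : ℝ}
    (hα : α ∈ Ioc (0 : ℝ) 1) :
    IsPositiveLinearOn (fun m => m.bind (Omega a φ α)) (Mn d 1) where
  add m m' := by
    ext s hs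
    have hm := measurable_Omega h α
    simp only [Measure.add_apply, Measure.bind_apply hs hm.aemeasurable, lintegral_add_measure]
  smul c m := by
    ext s hs
    have hm := measurable_Omega h α
    simp only [Measure.smul_apply, Measure.bind_apply hs hm.aemeasurable,
      lintegral_smul_measure]
  finite μ hμ := ⟨by
    rw [Measure.bind_apply MeasurableSet.univ (measurable_Omega h α).aemeasurable]
    simp only [Omega_univ h α]
    exact absIntegral_Phi_lt_top h hα hμ⟩

theorem signedExt_mem {T : Measure (Config d) → Measure (Config d)}
    (hT : ∀ m, m (tempered d)ᶜ = 0 → T m (tempered d)ᶜ = 0) {μ : SignedMeasure (Config d)}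
    (hμ : μ ∈ MStar d) : signedExt T μ ∈ MStar d := by
  have h0 : μ.toJordanDecomposition.posPart (tempered d)ᶜ
      + μ.toJordanDecomposition.negPart (tempered d)ᶜ = 0 := hμ
  rw [add_eq_zero] at h0
  have h1 := IsPositiveLinearOn.totalVariation_signedExt_le T μ (tempered d)ᶜ
  rw [Measure.add_apply, hT _ h0.1, hT _ h0.2, add_zero] at h1
  exact le_antisymm h1 bot_le

theorem opA_mem (a φ : Habitat d → ℝ) (α : ℝ) {μ : SignedMeasure (Config d)}
    (hμ : μ ∈ MStar d) : opA a φ α μ ∈ MStar d :=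
  (MStar d).neg_mem
    (signedExt_mem (fun m hm => withDensity_absolutelyContinuous m (Phi a φ α) hm) hμ)

theorem opB_mem {a φ : Habitat d → ℝ} (h : ModelAssumptions a φ) (α : ℝ)
    {μ : SignedMeasure (Config d)} (hμ : μ ∈ MStar d) : opB a φ α μ ∈ MStar d := by
  refine signedExt_mem (fun m hm => ?_) hμ
  have hae : ∀ᵐ γ ∂m, Omega a φ α γ (tempered d)ᶜ = 0 := by
    refine measure_mono_null (fun γ hγ => ?_) hm
    exact fun hγ' => hγ (Omega_compl_tempered h α hγ')
  rw [Measure.bind_apply measurableSet_tempered.compl (measurable_Omega h α).aemeasurable,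
    lintegral_congr_ae hae, lintegral_zero]

/-- The operator `L^{†,α} = A + B` in `M_*` with domain `M_1`. -/
def Ldag {a φ : Habitat d → ℝ} (h : ModelAssumptions a φ) {α : ℝ} (hα : α ∈ Ioc (0 : ℝ) 1) :
    MStar d →ₗ.[ℝ] MStar d where
  domain := (Mn d 1).comap (MStar d).subtype
  toFun :=
    { toFun := fun μ => ⟨opA a φ α (μ : MStar d) + opB a φ α (μ : MStar d),
        (MStar d).add_mem (opA_mem a φ α (μ : MStar d).2) (opB_mem h α (μ : MStar d).2)⟩
      map_add' := fun μ ν => Subtype.ext <| by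
        have hA := (isPositiveLinearOn_withDensity h hα).map_add μ.2 ν.2
        have hB := (isPositiveLinearOn_bind h hα).map_add μ.2 ν.2
        simp only [Submodule.subtype_apply] at hA hB
        simp only [opA, opB, Submodule.coe_add, hA, hB]
        abel
      map_smul' := fun c μ => Subtype.ext <| by
        have hA := (isPositiveLinearOn_withDensity h hα).map_smul c μ.2
        have hB := (isPositiveLinearOn_bind h hα).map_smul c μ.2
        simp only [Submodule.subtype_apply] at hA hB
        simp only [opA, opB, Submodule.coe_smul, hA, hB, RingHom.id_apply, smul_add, smul_neg] }

/-- A strongly continuous semigroup on `M_*` is stochastic if its operators are positive and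
preserve the norm of positive elements. -/
def IsStochastic (S : C0Semigroup (MStar d)) : Prop :=
  ∀ (t : ℝ≥0) (μ : MStar d), 0 ≤ (μ : SignedMeasure (Config d)) →
    0 ≤ (S.op t μ : SignedMeasure (Config d)) ∧ (‖μ‖ = 1 → ‖S.op t μ‖ = 1)

/-- `T_α(β, β') = α (β - β') / (e^β + 1)`. -/
def timeBound (α β β' : ℝ) : ℝ := α * (β - β') / (Real.exp β + 1)

end Kawasaki

end

open Kawasaki

/-! The operator describes a jump process on configurations whose total rate is unbounded but at
most linear, `Phi ≤ Ψ / α`, and a single jump raises Ψ by at most 1, because ψ ≤ 1 (`Psi_jump_le`).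
Together these two facts exclude explosion and control all the weights.

Suppress the jumps out of configurations with Ψ > N + 1. The remaining rates are at most (N + 1) /
α, so with the time step κ = α / (N + 1) the truncated generator is A_N = κ⁻¹ (P_N - 1)
(`truncGen`), where P_N (`chainOp`) is the transition operator of a Markov chain. For 0 ≤ τ ≤ κ the
operator 1 + τ A_N is a convex combination of 1 and P_N. Hence it is positive, contractive and mass
preserving, and Euler's formula hands these properties on to exp(t A_N). One such step multiplies
the integral of (1 + Ψ)^n by at most 1 + τ 3^n / α. The integral of e^{bΨ} after the step is at most
that of exp((b + τ (e^β + 1) / α) Ψ) before it, provided b ≤ β. Neither bound depends on N.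

The difference between `Ldag` and A_N only sees configurations with Ψ > N + 1, so it is O(1/N) on
bounded sets of M_2. Duhamel's formula and the second moment bound then make the orbits started in
M_2 uniformly Cauchy on bounded time intervals, and contractivity and density extend this to M_*.
The limit S inherits positivity and mass by norm convergence and the weight bounds by lower
semicontinuity.

On M_1 the A_N converge strongly to `Ldag`, so `Ldag μ` is the derivative at 0 of the orbit of μ
(`ConvergesTo.tendsto_quot`). As M_1 is dense and invariant under S, it is a core
(`IsContraction.generator_eq_closure`). Strong continuity on M_n follows by interpolating between
M_* and M_{n+1} and then by density. -/

noncomputable section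

namespace Kawasaki

namespace C0Semigroup

/-! ### Contraction semigroups: closed generators and invariant cores -/

section Core

variable {E : Type*} [NormedAddCommGroup E] [NormedSpace ℝ E]

/-- All operators of the semigroup are contractions. -/
def IsContraction (S : C0Semigroup E) : Prop := ∀ t x, ‖S.op t x‖ ≤ ‖x‖

theorem op_zero_apply (S : C0Semigroup E) (x : E) : S.op 0 x = x := by
  rw [S.op_zero]; rfl

theorem op_add_apply (S : C0Semigroup E) (s t : ℝ≥0) (x : E) :
    S.op (s + t) x = S.op s (S.op t x) := by
  rw [S.op_add]; rfl

theorem op_mul_sub_eq_sum (S : C0Semigroup E) (h : ℝ≥0) (k : ℕ) (x : E) :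
    S.op (k * h) x - x = ∑ j ∈ Finset.range k, S.op (j * h) (S.op h x - x) := by
  induction k with
  | zero => simp [S.op_zero_apply]
  | succ k ih =>
    rw [Finset.sum_range_succ, ← ih, map_sub, ← S.op_add_apply]
    push_cast
    rw [add_mul, one_mul]
    abel

theorem op_sub_eq_smul_quot (S : C0Semigroup E) (x : E) {t : ℝ≥0} (ht : t ≠ 0) :
    S.op t x - x = (t : ℝ) • S.quot x t := by
  rw [quot, smul_smul, mul_inv_cancel₀ (by exact_mod_cast ht), one_smul]

/-- The Riemann sum stands for the integral of the orbit of `y` over `[0, k h]`, which avoids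
vector-valued integration and needs no completeness. After telescoping, contractivity bounds each of
the `k` errors by `h` times the error of the difference quotient. -/
theorem IsContraction.norm_op_mul_sub_le {S : C0Semigroup E} (hS : S.IsContraction) {h : ℝ≥0}
    (hh : h ≠ 0) (k : ℕ) (x y : E) :
    ‖S.op (k * h) x - x - (h : ℝ) • ∑ j ∈ Finset.range k, S.op (j * h) y‖
      ≤ (k * h : ℝ≥0) * ‖S.quot x h - y‖ := by
  rw [S.op_mul_sub_eq_sum, Finset.smul_sum, ← Finset.sum_sub_distrib]
  refine (norm_sum_le_of_le (n := fun _ => (h : ℝ) * ‖S.quot x h - y‖) _ fun j _ => ?_).trans ?_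
  · rw [← map_smul, ← map_sub, S.op_sub_eq_smul_quot x hh, ← smul_sub]
    refine (hS _ _).trans ?_
    rw [norm_smul]
    simp
  · simp [mul_assoc]

theorem tendsto_div_nat_succ {t : ℝ≥0} (ht : t ≠ 0) :
    Tendsto (fun k : ℕ => t / ((k : ℝ≥0) + 1)) atTop (𝓝[>] 0) := by
  refine tendsto_nhdsWithin_iff.2 ⟨?_, Eventually.of_forall fun k => ?_⟩
  · have h := tendsto_one_div_add_atTop_nhds_zero_nat (𝕜 := ℝ≥0)
    simpa [div_eq_mul_inv] using h.const_mul t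
  · have : 0 < t := pos_iff_ne_zero.2 ht
    simp only [mem_Ioi]; positivity

theorem natSucc_mul_div (t : ℝ≥0) (k : ℕ) :
    ((k + 1 : ℕ) : ℝ≥0) * (t / ((k : ℝ≥0) + 1)) = t := by
  push_cast
  exact mul_div_cancel₀ t (by positivity)

theorem natCast_mul_div_le (t : ℝ≥0) {k j : ℕ} (hj : j < k + 1) :
    (j : ℝ≥0) * (t / ((k : ℝ≥0) + 1)) ≤ t := by
  rw [← mul_div_assoc, mul_comm, mul_div_assoc]
  refine mul_le_of_le_one_right' (div_le_one_of_le₀ ?_ (by positivity))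
  exact_mod_cast hj.le

/-- If `y` is the right derivative at `0` of the orbit of `x`, then the orbit is close to
`x + t y` as long as the orbit of `y` stays close to `y`. -/
theorem IsContraction.norm_op_sub_sub_smul_le {S : C0Semigroup E} (hS : S.IsContraction) {x y : E}
    (hxy : Tendsto (S.quot x) (𝓝[>] 0) (𝓝 y)) {t : ℝ≥0} {ε : ℝ}
    (hε : ∀ s ≤ t, ‖S.op s y - y‖ ≤ ε) : ‖S.op t x - x - (t : ℝ) • y‖ ≤ t * ε := by
  rcases eq_or_ne t 0 with rfl | ht
  · simp [S.op_zero_apply]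
  -- Refine the grid of step `t / (k + 1)`: the error of the difference quotient vanishes, and only
  -- the oscillation of the orbit of `y` remains.
  have hlim : Tendsto (fun k : ℕ => (t : ℝ) * ‖S.quot x (t / ((k : ℝ≥0) + 1)) - y‖ + t * ε) atTop
      (𝓝 (t * 0 + t * ε)) := by
    refine Tendsto.add_const _ (Tendsto.const_mul _ ?_)
    exact tendsto_iff_norm_sub_tendsto_zero.1 (hxy.comp (tendsto_div_nat_succ ht))
  rw [mul_zero, zero_add] at hlim
  refine ge_of_tendsto' hlim fun k => ?_
  set h : ℝ≥0 := t / ((k : ℝ≥0) + 1) with hh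
  have h0 : h ≠ 0 := by rw [hh]; positivity
  have e := hS.norm_op_mul_sub_le h0 (k + 1) x y
  rw [natSucc_mul_div] at e
  have e2 : (t : ℝ) • y = (h : ℝ) • ∑ j ∈ Finset.range (k + 1), y := by
    rw [Finset.sum_const, Finset.card_range, ← Nat.cast_smul_eq_nsmul ℝ, smul_smul, mul_comm]
    congr 1
    exact congrArg NNReal.toReal (natSucc_mul_div t k).symm
  have e3 : ‖(h : ℝ) • ∑ j ∈ Finset.range (k + 1), S.op (j * h) y - (t : ℝ) • y‖ ≤ t * ε := by
    rw [e2, ← smul_sub, ← Finset.sum_sub_distrib, norm_smul]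
    calc ‖(h : ℝ)‖ * ‖∑ j ∈ Finset.range (k + 1), (S.op (j * h) y - y)‖
        ≤ h * ((k + 1 : ℕ) * ε) := by
          rw [Real.norm_of_nonneg h.coe_nonneg]
          gcongr
          refine (norm_sum_le_of_le (n := fun _ => ε) _ fun j hj => ?_).trans (by simp)
          exact hε _ (natCast_mul_div_le t (Finset.mem_range.1 hj))
      _ = t * ε := by
          rw [← mul_assoc, mul_comm (h : ℝ)]
          congr 1
          exact congrArg NNReal.toReal (natSucc_mul_div t k)
  calc ‖S.op t x - x - (t : ℝ) • y‖
      = ‖(S.op t x - x - (h : ℝ) • ∑ j ∈ Finset.range (k + 1), S.op (j * h) y)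
        + ((h : ℝ) • ∑ j ∈ Finset.range (k + 1), S.op (j * h) y - (t : ℝ) • y)‖ := by
        congr 1; abel
    _ ≤ _ := (norm_add_le _ _).trans (add_le_add e e3)

theorem exists_forall_le_norm_op_sub_le (S : C0Semigroup E) (y : E) {ε : ℝ} (hε : 0 < ε) :
    ∃ t₀ > 0, ∀ t ≤ t₀, ‖S.op t y - y‖ ≤ ε := by
  have h := (tendsto_iff_norm_sub_tendsto_zero.1 (S.tendsto_zero y)).eventually_le_const hε
  obtain ⟨δ, hδ, h⟩ := Metric.eventually_nhds_iff.1 h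
  refine ⟨⟨δ / 2, by positivity⟩, by exact_mod_cast half_pos hδ, fun t ht => h ?_⟩
  rw [NNReal.dist_eq]
  have : (t : ℝ) ≤ δ / 2 := ht
  rw [NNReal.coe_zero, sub_zero, abs_of_nonneg t.coe_nonneg]
  linarith

theorem norm_quot_sub_le (S : C0Semigroup E) {x y : E} {t : ℝ≥0} (ht : 0 < t) {ε : ℝ}
    (h : ‖S.op t x - x - (t : ℝ) • y‖ ≤ t * ε) : ‖S.quot x t - y‖ ≤ ε := by
  rw [S.op_sub_eq_smul_quot x ht.ne', ← smul_sub, norm_smul, Real.norm_of_nonneg t.coe_nonneg] at h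
  exact le_of_mul_le_mul_left h (by exact_mod_cast ht)

theorem tendsto_quot_of_norm_le (S : C0Semigroup E) {x y : E}
    (h : ∀ ε > 0, ∃ t₀ > 0, ∀ t ≤ t₀, ‖S.op t x - x - (t : ℝ) • y‖ ≤ t * ε) :
    Tendsto (S.quot x) (𝓝[>] 0) (𝓝 y) := by
  refine Metric.tendsto_nhds.2 fun ε hε => ?_
  obtain ⟨t₀, ht₀, h⟩ := h (ε / 2) (half_pos hε)
  filter_upwards [Ioc_mem_nhdsGT ht₀] with t ht
  rw [dist_eq_norm]
  exact (S.norm_quot_sub_le ht.1 (h t ht.2)).trans_lt (half_lt_self hε)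

theorem mem_graph_generator (S : C0Semigroup E) (x y : E) :
    (x, y) ∈ S.generator.graph ↔ Tendsto (S.quot x) (𝓝[>] 0) (𝓝 y) := by
  rw [LinearPMap.mem_graph_iff]
  constructor
  · rintro ⟨z, rfl, rfl⟩
    exact z.2.choose_spec
  · intro h
    refine ⟨⟨x, y, h⟩, rfl, tendsto_nhds_unique ?_ h⟩
    exact Exists.choose_spec (⟨y, h⟩ : ∃ y, Tendsto (S.quot x) (𝓝[>] 0) (𝓝 y))

/-- At a fixed `t`, the first-order estimate of the orbit passes to the limit along a sequence in
the graph: by contractivity the orbit of `(u n).2` oscillates at most as much as that of `y`, up to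
`2 * ‖(u n).2 - y‖`. -/
theorem IsContraction.generator_isClosed {S : C0Semigroup E} (hS : S.IsContraction) :
    S.generator.IsClosed := by
  refine isClosed_of_closure_subset fun p hp => ?_
  obtain ⟨u, hu, hlim⟩ := mem_closure_iff_seq_limit.1 hp
  obtain ⟨x, y⟩ := p
  refine (S.mem_graph_generator x y).2 (S.tendsto_quot_of_norm_le fun ε hε => ?_)
  obtain ⟨t₀, ht₀, h⟩ := S.exists_forall_le_norm_op_sub_le y hε
  refine ⟨t₀, ht₀, fun t ht => ?_⟩
  have h1 : Tendsto (fun n => (u n).1) atTop (𝓝 x) := (continuous_fst.tendsto _).comp hlim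
  have h2 : Tendsto (fun n => (u n).2) atTop (𝓝 y) := (continuous_snd.tendsto _).comp hlim
  have h3 : Tendsto (fun n => ‖S.op t (u n).1 - (u n).1 - (t : ℝ) • (u n).2‖) atTop
      (𝓝 ‖S.op t x - x - (t : ℝ) • y‖) :=
    (((((S.op t).continuous.tendsto _).comp h1).sub h1).sub (h2.const_smul _)).norm
  have h4 : Tendsto (fun n => (t : ℝ) * (ε + 2 * ‖(u n).2 - y‖)) atTop
      (𝓝 (t * (ε + 2 * 0))) :=
    (((tendsto_iff_norm_sub_tendsto_zero.1 h2).const_mul 2).const_add ε).const_mul _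
  rw [mul_zero, add_zero] at h4
  refine le_of_tendsto_of_tendsto' h3 h4 fun n => ?_
  refine hS.norm_op_sub_sub_smul_le ((S.mem_graph_generator _ _).1 (hu n)) fun s hs => ?_
  have e : S.op s (u n).2 - (u n).2 = (S.op s ((u n).2 - y) + (S.op s y - y)) - ((u n).2 - y) := by
    rw [map_sub]; abel
  rw [e]
  have := hS s ((u n).2 - y)
  have := h s (hs.trans ht)
  linarith [norm_sub_le (S.op s ((u n).2 - y) + (S.op s y - y)) ((u n).2 - y),
    norm_add_le (S.op s ((u n).2 - y)) (S.op s y - y)]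

theorem tendsto_quot_op (S : C0Semigroup E) {x y : E} (h : Tendsto (S.quot x) (𝓝[>] 0) (𝓝 y))
    (s : ℝ≥0) : Tendsto (S.quot (S.op s x)) (𝓝[>] 0) (𝓝 (S.op s y)) := by
  refine (((S.op s).continuous.tendsto y).comp h).congr fun t => ?_
  simp only [Function.comp_apply, quot, map_smul, map_sub]
  rw [← S.op_add_apply, add_comm, S.op_add_apply]

/-- A dense subspace of the domain of the generator of a contraction semigroup that is invariant
under the semigroup is a core. -/
theorem IsContraction.generator_eq_closure {S : C0Semigroup E} (hS : S.IsContraction)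
    {L : E →ₗ.[ℝ] E} (hdense : Dense (L.domain : Set E))
    (hinv : ∀ t, ∀ x ∈ L.domain, S.op t x ∈ L.domain)
    (hgen : ∀ x : L.domain, Tendsto (S.quot x) (𝓝[>] 0) (𝓝 (L x))) :
    L.IsClosable ∧ S.generator = L.closure := by
  have hle : L.graph ≤ S.generator.graph := by
    rintro ⟨x, y⟩ hxy
    obtain ⟨z, rfl, rfl⟩ := (LinearPMap.mem_graph_iff _).1 hxy
    exact (S.mem_graph_generator _ _).2 (hgen z)
  have hcl : L.IsClosable := LinearPMap.isClosable_iff_exists_closed_extension.2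
    ⟨_, hS.generator_isClosed, LinearPMap.le_graph_iff.1 hle⟩
  refine ⟨hcl, LinearPMap.eq_of_eq_graph (le_antisymm ?_ ?_)⟩
  swap
  · rw [← hcl.graph_closure_eq_closure_graph]
    exact Submodule.topologicalClosure_minimal _ hle hS.generator_isClosed
  rw [← hcl.graph_closure_eq_closure_graph]
  rintro ⟨x, y⟩ hxy
  rw [mem_graph_generator] at hxy
  refine Metric.mem_closure_iff.2 fun ε hε => ?_
  obtain ⟨δ, hδ, hδε⟩ : ∃ δ > 0, 4 * δ < ε := ⟨ε / 8, by positivity, by linarith⟩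
  obtain ⟨t₀, ht₀, hx⟩ := S.exists_forall_le_norm_op_sub_le x hδ
  obtain ⟨t, htq, ht⟩ := (((tendsto_iff_norm_sub_tendsto_zero.1 hxy).eventually_le_const hδ).and
    (Ioc_mem_nhdsGT ht₀)).exists
  have htpos : (0 : ℝ) < t := by exact_mod_cast ht.1
  -- The tolerance `δ * t` compensates the factor `1 / t` in the difference quotient, whose values
  -- at `x'` and `x` must be close.
  obtain ⟨x', hx', hxx'⟩ := Metric.mem_closure_iff.1 (hdense x) (min δ (δ * t)) (by positivity)
  rw [dist_comm, dist_eq_norm] at hxx'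
  have hx1 := (hxx'.trans_le (min_le_left _ _)).le
  have hx2 := (hxx'.trans_le (min_le_right _ _)).le
  -- On an invariant domain `L` commutes with the semigroup, so whole orbits of pairs stay in the
  -- graph.
  have hL : ∀ s, (S.op s x', S.op s (L ⟨x', hx'⟩)) ∈ L.graph := by
    intro s
    refine (LinearPMap.mem_graph_iff _).2 ⟨⟨_, hinv s x' hx'⟩, rfl, ?_⟩
    exact tendsto_nhds_unique (hgen ⟨_, hinv s x' hx'⟩)
      (S.tendsto_quot_op (hgen ⟨x', hx'⟩) s)
  set y' := L ⟨x', hx'⟩ with hy'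
  have hk := ((tendsto_iff_norm_sub_tendsto_zero.1 (hgen ⟨x', hx'⟩)).comp
    (tendsto_div_nat_succ ht.1.ne')).eventually_le_const hδ
  obtain ⟨k, hk⟩ := hk.exists
  simp only [Function.comp_apply] at hk
  set h : ℝ≥0 := t / ((k : ℝ≥0) + 1) with hh
  have h0 : h ≠ 0 := by have := ht.1.ne'; rw [hh]; positivity
  have hkt : ((k : ℝ) + 1) * h = t := by
    rw [hh]; simpa using congrArg NNReal.toReal (natSucc_mul_div t k)
  -- The approximating point of the graph is a discrete time average of the orbit over `[0, t]`. Its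
  -- first component is near `x` by strong continuity. Its second one is nearly the difference
  -- quotient of `x'` at `t`, which is near that of `x`, hence near `y`.
  set z : E × E := ((k : ℝ) + 1)⁻¹ • ∑ j ∈ Finset.range (k + 1), (S.op (j * h) x', S.op (j * h) y')
    with hz
  refine ⟨z, L.graph.smul_mem _ (L.graph.sum_mem fun j _ => hL _), ?_⟩
  have hz1 : z.1 = ((k : ℝ) + 1)⁻¹ • ∑ j ∈ Finset.range (k + 1), S.op (j * h) x' := by
    simp [hz, Prod.fst_sum]
  have hz2 : z.2 = ((k : ℝ) + 1)⁻¹ • ∑ j ∈ Finset.range (k + 1), S.op (j * h) y' := by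
    simp [hz, Prod.snd_sum]
  have d1 : ‖z.1 - x‖ ≤ 2 * δ := by
    have e : z.1 - x = ((k : ℝ) + 1)⁻¹ •
        ∑ j ∈ Finset.range (k + 1), (S.op (j * h) (x' - x) + (S.op (j * h) x - x)) := by
      rw [hz1, eq_inv_smul_iff₀ (by positivity), smul_sub, smul_inv_smul₀ (by positivity)]
      simp only [map_sub, sub_add_sub_cancel, Finset.sum_sub_distrib, Finset.sum_const,
        Finset.card_range]
      rw [← Nat.cast_smul_eq_nsmul ℝ]
      push_cast; rfl
    rw [e, norm_smul, norm_inv, Real.norm_of_nonneg (by positivity : (0 : ℝ) ≤ (k : ℝ) + 1),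
      inv_mul_le_iff₀ (by positivity)]
    refine (norm_sum_le_of_le (n := fun _ => 2 * δ) _ fun j hj => ?_).trans (by simp)
    refine (norm_add_le _ _).trans ?_
    have := hS (j * h) (x' - x)
    have := hx (j * h) ((natCast_mul_div_le t (Finset.mem_range.1 hj)).trans ht.2)
    linarith
  have d2 : ‖z.2 - y‖ ≤ 4 * δ := by
    have e1 := hS.norm_op_mul_sub_le h0 (k + 1) x' y'
    rw [natSucc_mul_div] at e1
    have e2 : (h : ℝ) • ∑ j ∈ Finset.range (k + 1), S.op (j * h) y' = (t : ℝ) • z.2 := by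
      rw [hz2, smul_smul, ← hkt, mul_right_comm, mul_inv_cancel₀ (by positivity), one_mul]
    rw [e2] at e1
    have e3 := S.norm_quot_sub_le ht.1 (e1.trans (mul_le_mul_of_nonneg_left hk t.coe_nonneg))
    have e4 : ‖S.quot x' t - S.quot x t‖ ≤ 2 * δ := by
      have : S.quot x' t - S.quot x t = (t : ℝ)⁻¹ • (S.op t (x' - x) - (x' - x)) := by
        rw [quot, quot, ← smul_sub, map_sub]; congr 1; abel
      rw [this, norm_smul, norm_inv, Real.norm_of_nonneg t.coe_nonneg, inv_mul_le_iff₀ htpos]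
      have := hS t (x' - x)
      linarith [norm_sub_le (S.op t (x' - x)) (x' - x)]
    have e5 : z.2 - y = (S.quot x' t - S.quot x t) + (S.quot x t - y) - (S.quot x' t - z.2) := by
      abel
    rw [e5]
    linarith [norm_sub_le ((S.quot x' t - S.quot x t) + (S.quot x t - y)) (S.quot x' t - z.2),
      norm_add_le (S.quot x' t - S.quot x t) (S.quot x t - y)]
  rw [dist_comm, dist_eq_norm]
  refine (max_le (d1.trans (by linarith)) d2).trans_lt hδε

end Core

/-! ### Strong limits of contraction semigroups -/

section Limit

variable {E : Type*} [NormedAddCommGroup E] [NormedSpace ℝ E]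

/-- The semigroups `S N` converge to `S` strongly, uniformly on bounded time intervals. -/
def ConvergesTo (S : ℕ → C0Semigroup E) (S' : C0Semigroup E) : Prop :=
  ∀ x (T : ℝ≥0), TendstoUniformlyOn (fun N t => (S N).op t x) (fun t => S'.op t x) atTop (Iic T)

theorem ConvergesTo.tendsto {S : ℕ → C0Semigroup E} {S' : C0Semigroup E} (h : ConvergesTo S S')
    (x : E) (t : ℝ≥0) : Tendsto (fun N => (S N).op t x) atTop (𝓝 (S'.op t x)) :=
  (h x t).tendsto_at (mem_Iic.2 le_rfl)

theorem ConvergesTo.isContraction {S : ℕ → C0Semigroup E} {S' : C0Semigroup E}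
    (h : ConvergesTo S S') (hS : ∀ N, (S N).IsContraction) : S'.IsContraction :=
  fun t x => le_of_tendsto' (h.tendsto x t).norm fun N => hS N t x

/-- Contraction semigroups whose orbits are uniformly Cauchy on bounded time intervals for a dense
set of initial points converge to a strongly continuous semigroup. -/
theorem exists_convergesTo [CompleteSpace E] {S : ℕ → C0Semigroup E}
    (hS : ∀ N, (S N).IsContraction) {D : Set E} (hD : Dense D)
    (hcauchy : ∀ x ∈ D, ∀ T : ℝ≥0,
      UniformCauchySeqOn (fun N t => (S N).op t x) atTop (Iic T)) :
    ∃ S', ConvergesTo S S' := by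
  have hc : ∀ x (T : ℝ≥0), UniformCauchySeqOn (fun N t => (S N).op t x) atTop (Iic T) := by
    intro x T
    refine Metric.uniformCauchySeqOn_iff.2 fun ε hε => ?_
    obtain ⟨x', hx', hxx'⟩ := Metric.mem_closure_iff.1 (hD x) (ε / 3) (by positivity)
    obtain ⟨N, hN⟩ := Metric.uniformCauchySeqOn_iff.1 (hcauchy x' hx' T) (ε / 3) (by positivity)
    refine ⟨N, fun m hm n hn t ht => ?_⟩
    have h1 := hN m hm n hn t ht
    have h2 : ∀ k, dist ((S k).op t x) ((S k).op t x') ≤ dist x x' := fun k => by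
      rw [dist_eq_norm, dist_eq_norm, ← map_sub]
      exact hS k t _
    have h3 := h2 n
    rw [dist_comm ((S n).op t x)] at h3
    linarith [h2 m, dist_triangle4 ((S m).op t x) ((S m).op t x') ((S n).op t x') ((S n).op t x)]
  have hlim : ∀ (t : ℝ≥0) x, ∃ y, Tendsto (fun N => (S N).op t x) atTop (𝓝 y) := fun t x =>
    cauchySeq_tendsto_of_complete ((hc x t).cauchySeq (mem_Iic.2 le_rfl))
  choose U hU using hlim
  have hUnorm : ∀ t x, ‖U t x‖ ≤ ‖x‖ := fun t x =>
    le_of_tendsto' (hU t x).norm fun N => hS N t x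
  have hUadd : ∀ t x y, U t (x + y) = U t x + U t y := fun t x y =>
    tendsto_nhds_unique (hU t (x + y)) (((hU t x).add (hU t y)).congr fun N => by rw [map_add])
  have hUsmul : ∀ t (c : ℝ) x, U t (c • x) = c • U t x := fun t c x =>
    tendsto_nhds_unique (hU t (c • x)) (((hU t x).const_smul c).congr fun N => by rw [map_smul])
  have hUunif : ∀ x (T : ℝ≥0),
      TendstoUniformlyOn (fun N t => (S N).op t x) (fun t => U t x) atTop (Iic T) := fun x T =>
    (hc x T).tendstoUniformlyOn_of_tendsto fun t _ => hU t x
  let op : ℝ≥0 → E →L[ℝ] E := fun t =>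
    LinearMap.mkContinuous ⟨⟨U t, hUadd t⟩, hUsmul t⟩ 1 fun x => by simpa using hUnorm t x
  have hop : ∀ t x, op t x = U t x := fun _ _ => rfl
  refine ⟨⟨op, ?_, ?_, ?_⟩, hUunif⟩
  · ext x
    rw [hop]
    refine tendsto_nhds_unique (hU 0 x) ?_
    simp only [op_zero_apply]
    exact tendsto_const_nhds
  · intro s t
    ext x
    rw [ContinuousLinearMap.comp_apply, hop, hop, hop]
    refine tendsto_nhds_unique (hU (s + t) x) ?_
    -- For the semigroup law the moving argument `(S N).op t x` may be replaced by its limit,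
    -- because the outer operators are contractions.
    have h1 : Tendsto (fun N => (S N).op s ((S N).op t x - U t x)) atTop (𝓝 0) :=
      squeeze_zero_norm (fun N => hS N s _) (tendsto_iff_norm_sub_tendsto_zero.1 (hU t x))
    refine ((h1.add (hU s (U t x))).congr fun N => ?_).trans (by rw [zero_add])
    rw [map_sub, sub_add_cancel, op_add_apply]
  · intro x
    refine Metric.tendsto_nhds.2 fun ε hε => ?_
    -- Uniformity in time lets a single `N` serve for all small `t`.
    obtain ⟨N, hN⟩ := (Metric.tendstoUniformlyOn_iff.1 (hUunif x 1) (ε / 2)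
      (by positivity)).exists
    filter_upwards [Metric.tendsto_nhds.1 ((S N).tendsto_zero x) (ε / 2) (by positivity),
      Iic_mem_nhds (zero_lt_one' ℝ≥0)] with t h1 h2
    rw [hop]
    linarith [hN t h2, dist_triangle (U t x) ((S N).op t x) x]

/-- The first-order estimate for the orbit of `x` under `S N` has derivative `u N` and an error that
is uniform in large `N`: the oscillation of the orbit of `u N` under `S N` is compared with that of
the orbit of `y` under the limit. Then `N` goes to infinity at a fixed time. -/
theorem ConvergesTo.tendsto_quot {S : ℕ → C0Semigroup E} {S' : C0Semigroup E}
    (h : ConvergesTo S S') (hS : ∀ N, (S N).IsContraction) {x y : E} {u : ℕ → E}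
    (hu : ∀ N, Tendsto ((S N).quot x) (𝓝[>] 0) (𝓝 (u N))) (hy : Tendsto u atTop (𝓝 y)) :
    Tendsto (S'.quot x) (𝓝[>] 0) (𝓝 y) := by
  refine S'.tendsto_quot_of_norm_le fun ε hε => ?_
  obtain ⟨t₀, ht₀, ht⟩ := S'.exists_forall_le_norm_op_sub_le y (half_pos hε)
  refine ⟨t₀, ht₀, fun t htt => ?_⟩
  refine le_of_tendsto ((((h.tendsto x t).sub_const x).sub (hy.const_smul (t : ℝ))).norm) ?_
  filter_upwards [(tendsto_iff_norm_sub_tendsto_zero.1 hy).eventually_le_const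
      (show 0 < ε / 8 by positivity),
    Metric.tendstoUniformlyOn_iff.1 (h y t) (ε / 4) (by positivity)] with N h1 h2
  refine (hS N).norm_op_sub_sub_smul_le (hu N) fun s hs => ?_
  have e : (S N).op s (u N) - u N = (S N).op s (u N - y) + ((S N).op s y - S'.op s y)
      + (S'.op s y - y) - (u N - y) := by
    rw [map_sub]; abel
  have h3 := h2 s hs
  rw [dist_comm, dist_eq_norm] at h3
  rw [e]
  have h4 := hS N s (u N - y)
  have h5 := ht s (hs.trans htt)
  linarith [norm_sub_le ((S N).op s (u N - y) + ((S N).op s y - S'.op s y) + (S'.op s y - y))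
      (u N - y), norm_add_le ((S N).op s (u N - y) + ((S N).op s y - S'.op s y)) (S'.op s y - y),
    norm_add_le ((S N).op s (u N - y)) ((S N).op s y - S'.op s y)]

end Limit

/-! ### Exponentials of bounded operators -/

section Bounded

variable {E : Type*} [NormedAddCommGroup E] [NormedSpace ℝ E]

theorem norm_pow_le_one {Y : E →L[ℝ] E} (hY : ‖Y‖ ≤ 1) (k : ℕ) : ‖Y ^ k‖ ≤ 1 := by
  induction k with
  | zero => exact (pow_zero Y).symm ▸ ContinuousLinearMap.norm_id_le
  | succ k ih =>
    rw [pow_succ]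
    exact (norm_mul_le _ _).trans (mul_le_one₀ ih (norm_nonneg _) hY)

/-- Used for `X = exp (h A)` and `Y = 1 + h A`. Only `Y` is known to be a contraction, so the powers
of `X` are controlled through their distance to it. The bound is small once `k * ‖X - Y‖` is. -/
theorem norm_pow_sub_pow_le {X Y : E →L[ℝ] E} (hY : ‖Y‖ ≤ 1) (k : ℕ) :
    ‖X ^ k - Y ^ k‖ ≤ (1 + ‖X - Y‖) ^ k - 1 := by
  have hX : ‖X‖ ≤ 1 + ‖X - Y‖ := by
    have := norm_add_le Y (X - Y)
    rw [add_sub_cancel] at this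
    linarith
  induction k with
  | zero => simp
  | succ k ih =>
    have e : X ^ (k + 1) - Y ^ (k + 1) = X * (X ^ k - Y ^ k) + (X - Y) * Y ^ k := by
      rw [pow_succ', pow_succ']; noncomm_ring
    rw [e]
    calc ‖X * (X ^ k - Y ^ k) + (X - Y) * Y ^ k‖
        ≤ ‖X‖ * ‖X ^ k - Y ^ k‖ + ‖X - Y‖ * ‖Y ^ k‖ :=
          (norm_add_le _ _).trans (add_le_add (norm_mul_le _ _) (norm_mul_le _ _))
      _ ≤ (1 + ‖X - Y‖) * ((1 + ‖X - Y‖) ^ k - 1) + ‖X - Y‖ * 1 := by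
          gcongr
          exact norm_pow_le_one hY k
      _ = _ := by ring

variable [CompleteSpace E]

open NormedSpace in
/-- The semigroup `exp (t A)` of a bounded operator `A`. -/
def ofBounded (A : E →L[ℝ] E) : C0Semigroup E where
  op t := exp ((t : ℝ) • A)
  op_zero := by
    rw [NNReal.coe_zero, zero_smul, exp_zero]; rfl
  op_add s t := by
    let _ : NormedAlgebra ℚ (E →L[ℝ] E) := NormedAlgebra.restrictScalars ℚ ℝ _
    rw [NNReal.coe_add, add_smul, exp_add_of_commute
      (((Commute.refl A).smul_left _).smul_right _)]
    rfl
  tendsto_zero x := by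
    have h := (hasDerivAt_exp_smul_const A (0 : ℝ)).continuousAt.tendsto
    rw [zero_smul, exp_zero] at h
    exact ((ContinuousLinearMap.apply ℝ E x).continuous.tendsto _).comp
      (h.comp (NNReal.continuous_coe.tendsto' 0 0 NNReal.coe_zero))

theorem ofBounded_op (A : E →L[ℝ] E) (t : ℝ≥0) :
    (ofBounded A).op t = NormedSpace.exp ((t : ℝ) • A) := rfl

theorem tendsto_quot_ofBounded (A : E →L[ℝ] E) (x : E) :
    Tendsto ((ofBounded A).quot x) (𝓝[>] 0) (𝓝 (A x)) := by
  have h := (hasDerivAt_exp_smul_const A (0 : ℝ)).tendsto_slope_zero_right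
  rw [zero_smul, NormedSpace.exp_zero, one_mul] at h
  have h2 : Tendsto (fun t : ℝ≥0 => (t : ℝ)) (𝓝[>] 0) (𝓝[>] 0) := by
    refine tendsto_nhdsWithin_iff.2 ⟨?_, ?_⟩
    · exact (NNReal.continuous_coe.tendsto' 0 0 NNReal.coe_zero).mono_left nhdsWithin_le_nhds
    · filter_upwards [self_mem_nhdsWithin] with t ht
      exact NNReal.coe_pos.2 ht
  refine (((ContinuousLinearMap.apply ℝ E x).continuous.tendsto _).comp (h.comp h2)).congr
    fun t => ?_
  simp [quot, ofBounded_op]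

/-- Euler's formula for the exponential of a bounded operator. -/
theorem tendsto_one_add_smul_pow {A : E →L[ℝ] E} {h₀ : ℝ} (hh₀ : 0 < h₀)
    (hA : ∀ h, 0 ≤ h → h ≤ h₀ → ‖1 + h • A‖ ≤ 1) (t : ℝ≥0) :
    Tendsto (fun k : ℕ => (1 + ((t / ((k : ℝ≥0) + 1) : ℝ≥0) : ℝ) • A) ^ (k + 1)) atTop
      (𝓝 ((ofBounded A).op t)) := by
  set h : ℕ → ℝ := fun k => ((t / ((k : ℝ≥0) + 1) : ℝ≥0) : ℝ) with hh
  have hk : ∀ k : ℕ, ((k : ℝ) + 1) * h k = t := fun k => by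
    simpa [hh] using congrArg NNReal.toReal (natSucc_mul_div t k)
  have hh0 : Tendsto h atTop (𝓝 0) := by
    have := (tendsto_one_div_add_atTop_nhds_zero_nat (𝕜 := ℝ)).const_mul (t : ℝ)
    simpa [hh, div_eq_mul_inv] using this
  have hexp : ∀ k, (ofBounded A).op t = NormedSpace.exp (h k • A) ^ (k + 1) := fun k => by
    let _ : NormedAlgebra ℚ (E →L[ℝ] E) := NormedAlgebra.restrictScalars ℚ ℝ _
    rw [ofBounded_op, ← NormedSpace.exp_nsmul, ← Nat.cast_smul_eq_nsmul ℝ, smul_smul]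
    congr 2
    push_cast
    exact (hk k).symm
  set δ : ℕ → ℝ := fun k => ‖NormedSpace.exp (h k • A) - (1 + h k • A)‖ with hδ
  -- Differentiability of the exponential at 0 gives `δ k = o(h k)`, while `(k + 1) * h k = t` stays
  -- fixed.
  have hδ0 : Tendsto (fun k : ℕ => ((k : ℝ) + 1) * δ k) atTop (𝓝 0) := by
    have hd := (hasDerivAt_exp_smul_const A (0 : ℝ)).isLittleO
    rw [zero_smul, NormedSpace.exp_zero, one_mul] at hd
    have hd' := hd.comp_tendsto hh0
    have := (Asymptotics.isBigO_refl (fun k : ℕ => (k : ℝ) + 1) atTop).mul_isLittleO hd'.norm_left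
    have h2 : (fun k : ℕ => ((k : ℝ) + 1) * δ k) =o[atTop] fun _ => (t : ℝ) := by
      refine this.congr (fun k => ?_) fun k => ?_
      · simp [hδ, sub_add_eq_sub_sub]
      · simpa using hk k
    exact (Asymptotics.isLittleO_one_iff ℝ).1
      (h2.trans_isBigO (Asymptotics.isBigO_const_const (t : ℝ) (one_ne_zero (α := ℝ)) atTop))
  rw [tendsto_iff_norm_sub_tendsto_zero]
  have hup : Tendsto (fun k : ℕ => Real.exp (((k : ℝ) + 1) * δ k) - 1) atTop (𝓝 0) := by
    simpa using ((Real.continuous_exp.tendsto 0).comp hδ0).sub_const 1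
  refine squeeze_zero' (Eventually.of_forall fun _ => norm_nonneg _) ?_ hup
  filter_upwards [hh0.eventually_le_const hh₀] with k hkle
  rw [norm_sub_rev, hexp k]
  refine (norm_pow_sub_pow_le (hA _ (NNReal.coe_nonneg _) hkle) _).trans ?_
  have : (1 + δ k) ^ (k + 1) ≤ Real.exp (((k : ℝ) + 1) * δ k) := by
    have h1 : 1 + δ k ≤ Real.exp (δ k) := by linarith [Real.add_one_le_exp (δ k)]
    have h2 := pow_le_pow_left₀ (by positivity) h1 (k + 1)
    rw [← Real.exp_nat_mul] at h2
    exact_mod_cast h2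
  linarith

theorem isContraction_ofBounded {A : E →L[ℝ] E} {h₀ : ℝ} (hh₀ : 0 < h₀)
    (hA : ∀ h, 0 ≤ h → h ≤ h₀ → ‖1 + h • A‖ ≤ 1) : (ofBounded A).IsContraction := by
  intro t x
  refine (ContinuousLinearMap.le_of_opNorm_le _ ?_ x).trans (one_mul ‖x‖).le
  refine le_of_tendsto (tendsto_one_add_smul_pow hh₀ hA t).norm ?_
  have hh0 : Tendsto (fun k : ℕ => ((t / ((k : ℝ≥0) + 1) : ℝ≥0) : ℝ)) atTop (𝓝 0) := by
    have := (tendsto_one_div_add_atTop_nhds_zero_nat (𝕜 := ℝ)).const_mul (t : ℝ)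
    simpa [div_eq_mul_inv] using this
  filter_upwards [hh0.eventually_le_const hh₀] with k hk
  exact (norm_pow_le' _ k.succ_pos).trans (pow_le_one₀ (norm_nonneg _)
    (hA _ (NNReal.coe_nonneg _) hk))

/-- Duhamel's estimate for the difference of two exponentials. -/
theorem norm_ofBounded_sub_le {A B : E →L[ℝ] E} (hB : (ofBounded B).IsContraction) {x : E}
    {t : ℝ≥0} {C : ℝ} (hC : ∀ s ≤ t, ‖A ((ofBounded A).op s x) - B ((ofBounded A).op s x)‖ ≤ C) :
    ‖(ofBounded A).op t x - (ofBounded B).op t x‖ ≤ C * t := by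
  -- This path joins `exp (t B) x` to `exp (t A) x`. Its derivative involves `A - B` only along the
  -- orbit of `x` under `A`, which matters because the bound on the difference of the generators
  -- holds only for measures with controlled moments.
  set f : ℝ → E := fun s => NormedSpace.exp ((t - s) • B) (NormedSpace.exp (s • A) x) with hf
  have hd : ∀ s : ℝ, HasDerivAt f (NormedSpace.exp ((t - s) • B)
      (A (NormedSpace.exp (s • A) x) - B (NormedSpace.exp (s • A) x))) s := by
    intro s
    have h1 := (hasDerivAt_exp_smul_const B ((t : ℝ) - s)).scomp s
      ((hasDerivAt_id s).const_sub (t : ℝ))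
    have h2 := (hasDerivAt_exp_smul_const' A s).clm_apply (hasDerivAt_const s x)
    have h3 := h1.clm_apply h2
    refine h3.congr_deriv ?_
    simp [sub_eq_neg_add]
  have := norm_image_sub_le_of_norm_deriv_le_segment' (f := f) (a := 0) (b := t) (C := C)
    (fun s _ => (hd s).hasDerivWithinAt) (fun s hs => ?_) t ⟨t.coe_nonneg, le_rfl⟩
  · simpa [hf, ofBounded_op] using this
  · have hs1 : (⟨s, hs.1⟩ : ℝ≥0) ≤ t := hs.2.le
    have h1 := hC ⟨s, hs.1⟩ hs1
    refine le_trans ?_ h1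
    have h2 := hB ⟨t - s, sub_nonneg.2 hs.2.le⟩
      (A (NormedSpace.exp (s • A) x) - B (NormedSpace.exp (s • A) x))
    exact h2

end Bounded

end C0Semigroup

/-! ### Weighted total variation and Jordan parts -/

section Signed

variable {X : Type*} [MeasurableSpace X]

theorem absIntegral_add_le (w : X → ℝ≥0∞) (μ ν : SignedMeasure X) :
    absIntegral w (μ + ν) ≤ absIntegral w μ + absIntegral w ν := by
  refine (lintegral_mono' (totalVariation_add_le μ ν) le_rfl).trans_eq ?_
  rw [lintegral_add_measure]; rfl

theorem absIntegral_smul (w : X → ℝ≥0∞) (c : ℝ) (μ : SignedMeasure X) :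
    absIntegral w (c • μ) = ‖c‖ₑ * absIntegral w μ := by
  rw [absIntegral, totalVariation_smul, lintegral_smul_measure]; rfl

theorem absIntegral_neg (w : X → ℝ≥0∞) (μ : SignedMeasure X) :
    absIntegral w (-μ) = absIntegral w μ := by
  rw [absIntegral, SignedMeasure.totalVariation_neg]; rfl

theorem absIntegral_sub_le (w : X → ℝ≥0∞) (μ ν : SignedMeasure X) :
    absIntegral w (μ - ν) ≤ absIntegral w μ + absIntegral w ν := by
  rw [sub_eq_add_neg, ← absIntegral_neg w ν]
  exact absIntegral_add_le w μ (-ν)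

theorem absIntegral_mono {w w' : X → ℝ≥0∞} (h : ∀ x, w x ≤ w' x) (μ : SignedMeasure X) :
    absIntegral w μ ≤ absIntegral w' μ := lintegral_mono h

theorem absIntegral_const_mul {w : X → ℝ≥0∞} (hw : Measurable w) (c : ℝ≥0∞)
    (μ : SignedMeasure X) : absIntegral (fun x => c * w x) μ = c * absIntegral w μ :=
  lintegral_const_mul c hw

theorem totalVariation_eq_add (μ : SignedMeasure X) :
    μ.totalVariation = μ.toJordanDecomposition.posPart + μ.toJordanDecomposition.negPart := rfl

theorem eq_toSigned_sub (μ : SignedMeasure X) :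
    μ = toSigned μ.toJordanDecomposition.posPart - toSigned μ.toJordanDecomposition.negPart := by
  rw [toSigned_eq, toSigned_eq]
  exact (SignedMeasure.toSignedMeasure_toJordanDecomposition μ).symm

theorem totalVariation_toSigned (m : Measure X) [IsFiniteMeasure m] :
    (toSigned m).totalVariation = m := by
  rw [SignedMeasure.totalVariation_eq_variation, toSigned_eq, Measure.variation_toSignedMeasure]

theorem totalVariation_toSigned_le (m : Measure X) : (toSigned m).totalVariation ≤ m := by
  by_cases h : IsFiniteMeasure m
  · rw [totalVariation_toSigned]
  · simp only [toSigned, h, dite_false, SignedMeasure.totalVariation_zero]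
    exact bot_le

theorem totalVariation_toSigned_sub_le (m m' : Measure X) :
    (toSigned m - toSigned m').totalVariation ≤ m + m' := by
  rw [sub_eq_add_neg]
  refine (totalVariation_add_le _ _).trans ?_
  rw [SignedMeasure.totalVariation_neg]
  exact add_le_add (totalVariation_toSigned_le m) (totalVariation_toSigned_le m')

theorem absIntegral_toSigned_sub_le (w : X → ℝ≥0∞) (m m' : Measure X) :
    absIntegral w (toSigned m - toSigned m') ≤ ∫⁻ x, w x ∂m + ∫⁻ x, w x ∂m' := by
  rw [← lintegral_add_measure]
  exact lintegral_mono' (totalVariation_toSigned_sub_le m m') le_rfl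

theorem absIntegral_signedExt_le (w : X → ℝ≥0∞) (T : Measure X → Measure X)
    (μ : SignedMeasure X) :
    absIntegral w (signedExt T μ) ≤ ∫⁻ x, w x ∂(T μ.toJordanDecomposition.posPart)
      + ∫⁻ x, w x ∂(T μ.toJordanDecomposition.negPart) :=
  absIntegral_toSigned_sub_le w _ _

theorem absIntegral_eq_add (w : X → ℝ≥0∞) (μ : SignedMeasure X) :
    absIntegral w μ = ∫⁻ x, w x ∂μ.toJordanDecomposition.posPart
      + ∫⁻ x, w x ∂μ.toJordanDecomposition.negPart := by
  rw [absIntegral, totalVariation_eq_add, lintegral_add_measure]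

theorem toSigned_apply (m : Measure X) [IsFiniteMeasure m] {s : Set X} (hs : MeasurableSet s) :
    toSigned m s = m.real s := by
  rw [toSigned_eq, Measure.toSignedMeasure_apply_measurable hs]

theorem toSigned_nonneg (m : Measure X) : 0 ≤ toSigned m := by
  by_cases h : IsFiniteMeasure m
  · rw [toSigned_eq]; exact Measure.zero_le_toSignedMeasure m
  · simp [toSigned, h]

theorem toSigned_zero : toSigned (0 : Measure X) = 0 := by
  rw [toSigned_eq, Measure.toSignedMeasure_zero]

theorem exists_toSigned_of_nonneg {μ : SignedMeasure X} (hμ : 0 ≤ μ) :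
    ∃ m : Measure X, IsFiniteMeasure m ∧ μ = toSigned m := by
  have h := (VectorMeasure.le_restrict_univ_iff_le 0 μ).2 hμ
  refine ⟨μ.toMeasureOfZeroLE univ MeasurableSet.univ h, inferInstance, ?_⟩
  rw [toSigned_eq, SignedMeasure.toMeasureOfZeroLE_toSignedMeasure]

theorem toJordanDecomposition_toSigned (m : Measure X) [IsFiniteMeasure m] :
    (toSigned m).toJordanDecomposition =
      ⟨m, 0, Measure.MutuallySingular.zero_right⟩ := by
  refine SignedMeasure.toJordanDecomposition_eq ?_
  rw [toSigned_eq, JordanDecomposition.toSignedMeasure]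
  simp

theorem signedExt_toSigned {T : Measure X → Measure X} (hT : T 0 = 0) (m : Measure X)
    [IsFiniteMeasure m] : signedExt T (toSigned m) = toSigned (T m) := by
  rw [signedExt, toJordanDecomposition_toSigned]
  simp [hT, toSigned_zero]

/-- Each Jordan part splits along `A` and its complement, so the error of truncating to `A` is again
a restriction. -/
theorem sub_signedExt_restrict (μ : SignedMeasure X) {A : Set X} (hA : MeasurableSet A) :
    μ - signedExt (fun m => m.restrict A) μ = signedExt (fun m => m.restrict Aᶜ) μ := by
  have h : ∀ m : Measure X, IsFiniteMeasure m →
      toSigned m = toSigned (m.restrict A) + toSigned (m.restrict Aᶜ) := fun m _ => by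
    rw [← toSigned_add, Measure.restrict_add_restrict_compl hA]
  have e := eq_toSigned_sub μ
  rw [h _ (μ.toJordanDecomposition.posPart_finite),
    h _ (μ.toJordanDecomposition.negPart_finite)] at e
  rw [sub_eq_iff_eq_add]
  refine e.trans ?_
  simp only [signedExt]
  abel

theorem absIntegral_signedExt_restrict_le (w : X → ℝ≥0∞) (μ : SignedMeasure X) (A : Set X) :
    absIntegral w (signedExt (fun m => m.restrict A) μ) ≤ ∫⁻ x in A, w x ∂μ.totalVariation := by
  refine (absIntegral_signedExt_le w _ μ).trans_eq ?_
  rw [totalVariation_eq_add, Measure.restrict_add, lintegral_add_measure]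

end Signed

variable {d : ℕ}

/-! ### Norm limits in `M_*` and its completeness -/

theorem MStar_ofReal_norm (μ : MStar d) :
    ENNReal.ofReal ‖μ‖ = absIntegral (fun _ => 1) (μ : SignedMeasure (Config d)) :=
  ENNReal.ofReal_toReal (MStar_finite _).ne

theorem Mn_ofReal_norm {n : ℕ} (μ : Mn d n) : ENNReal.ofReal ‖μ‖
    = absIntegral (fun γ => (1 + Psi γ) ^ n) (μ : SignedMeasure (Config d)) :=
  ENNReal.ofReal_toReal μ.2.ne

theorem MStar_norm_le_of_absIntegral_le {μ : MStar d} {C : ℝ} (hC : 0 ≤ C)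
    (h : absIntegral (fun _ => 1) (μ : SignedMeasure (Config d)) ≤ ENNReal.ofReal C) :
    ‖μ‖ ≤ C := by
  rw [← MStar_ofReal_norm] at h
  exact (ENNReal.ofReal_le_ofReal_iff hC).1 h

theorem MStar_abs_apply_le (μ : MStar d) (s : Set (Config d)) :
    |(μ : SignedMeasure (Config d)) s| ≤ ‖μ‖ := by
  rw [MStar_norm]
  refine (SignedMeasure.norm_le_totalVariation _ s).trans ?_
  exact measureReal_mono (subset_univ s)

theorem MStar_tendsto_apply {ι : Type*} {l : Filter ι} {u : ι → MStar d} {μ : MStar d}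
    (h : Tendsto u l (𝓝 μ)) (s : Set (Config d)) :
    Tendsto (fun k => (u k : SignedMeasure (Config d)) s) l
      (𝓝 ((μ : SignedMeasure (Config d)) s)) := by
  rw [tendsto_iff_norm_sub_tendsto_zero] at h ⊢
  refine squeeze_zero (fun _ => norm_nonneg _) (fun k => ?_) h
  exact MStar_abs_apply_le (u k - μ) s

theorem MStar_nonneg_of_tendsto {ι : Type*} {l : Filter ι} [l.NeBot] {u : ι → MStar d}
    {μ : MStar d} (h : Tendsto u l (𝓝 μ))
    (hu : ∀ᶠ k in l, 0 ≤ (u k : SignedMeasure (Config d))) :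
    0 ≤ (μ : SignedMeasure (Config d)) := by
  refine VectorMeasure.le_iff.2 fun s hs => ?_
  refine ge_of_tendsto (MStar_tendsto_apply h s) ?_
  filter_upwards [hu] with k hk
  exact hk s hs

theorem MStar_norm_of_nonneg {μ : MStar d} (hμ : 0 ≤ (μ : SignedMeasure (Config d))) :
    ‖μ‖ = (μ : SignedMeasure (Config d)) univ := by
  obtain ⟨m, hm, e⟩ := exists_toSigned_of_nonneg hμ
  rw [MStar_norm, e, totalVariation_toSigned, toSigned_apply m MeasurableSet.univ]
  rfl

/-- The weighted total variation is lower semicontinuous. -/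
theorem MStar_absIntegral_le_of_tendsto {ι : Type*} {l : Filter ι} [l.NeBot] {u : ι → MStar d}
    {μ : MStar d} (h : Tendsto u l (𝓝 μ)) {w : Config d → ℝ≥0∞} (hw : Measurable w) {C : ℝ≥0∞}
    (hu : ∀ᶠ k in l, absIntegral w (u k : SignedMeasure (Config d)) ≤ C) :
    absIntegral w (μ : SignedMeasure (Config d)) ≤ C := by
  -- With the weight capped at `M`, replacing `μ` by `u k` costs at most `M * ‖u k - μ‖`. Monotone
  -- convergence removes the cap afterwards.
  have hbdd : ∀ M : ℕ, absIntegral (fun γ => min (w γ) M) (μ : SignedMeasure (Config d)) ≤ C := by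
    intro M
    have hlim : Tendsto (fun k => C + M * ENNReal.ofReal ‖u k - μ‖) l (𝓝 (C + M * 0)) := by
      refine Tendsto.const_add _ (ENNReal.Tendsto.const_mul ?_ (Or.inr (by simp)))
      simpa using ENNReal.tendsto_ofReal (tendsto_iff_norm_sub_tendsto_zero.1 h)
    rw [mul_zero, add_zero] at hlim
    refine ge_of_tendsto hlim ?_
    filter_upwards [hu] with k hk
    have e : μ.1 = (u k).1 - (u k - μ).1 := by
      rw [Submodule.coe_sub]; abel
    rw [e]
    refine (absIntegral_sub_le _ _ _).trans (add_le_add ?_ ?_)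
    · exact (absIntegral_mono (fun γ => min_le_left _ _) _).trans hk
    · rw [MStar_ofReal_norm, ← absIntegral_const_mul measurable_const]
      exact absIntegral_mono (fun γ => by simp) _
  have hsup : ∀ γ, w γ = ⨆ M : ℕ, min (w γ) M := fun γ => by
    rw [← inf_iSup_eq, ENNReal.iSup_natCast, inf_top_eq]
  rw [absIntegral, lintegral_congr hsup, lintegral_iSup (fun M => hw.min measurable_const)]
  · exact iSup_le hbdd
  · intro M N hMN γ
    exact min_le_min le_rfl (by exact_mod_cast hMN)

/-- An absolutely convergent series is summed separately over the positive and the negative Jordan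
parts. Both sums are finite measures, and the remainders are dominated by the tails of the series of
norms. -/
instance : CompleteSpace (MStar d) := by
  refine NormedAddCommGroup.completeSpace_of_summable_imp_tendsto fun u hu => ?_
  set p : ℕ → Measure (Config d) := fun k => (u k).1.toJordanDecomposition.posPart with hp
  set q : ℕ → Measure (Config d) := fun k => (u k).1.toJordanDecomposition.negPart with hq
  have hpq : ∀ k, (u k).1.totalVariation = p k + q k := fun k => rfl
  have hnorm : ∀ k, (p k + q k) univ = ENNReal.ofReal ‖u k‖ := fun k => by
    rw [MStar_ofReal_norm, absIntegral, lintegral_one, hpq]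
  have hsum : ∑' k, (p k + q k) univ ≠ ∞ := by
    simp only [hnorm]
    rw [← ENNReal.ofReal_tsum_of_nonneg (fun _ => norm_nonneg _) hu]
    exact ENNReal.ofReal_ne_top
  have hfp : ∀ n, IsFiniteMeasure (Measure.sum fun k => p (k + n)) := fun n => ⟨by
    rw [Measure.sum_apply _ MeasurableSet.univ]
    refine lt_of_le_of_lt ?_ hsum.lt_top
    refine (ENNReal.tsum_le_tsum fun k => ?_).trans
      (ENNReal.tsum_comp_le_tsum_of_injective (add_left_injective n) fun k => (p k + q k) univ)
    exact le_self_add⟩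
  have hfq : ∀ n, IsFiniteMeasure (Measure.sum fun k => q (k + n)) := fun n => ⟨by
    rw [Measure.sum_apply _ MeasurableSet.univ]
    refine lt_of_le_of_lt ?_ hsum.lt_top
    refine (ENNReal.tsum_le_tsum fun k => ?_).trans
      (ENNReal.tsum_comp_le_tsum_of_injective (add_left_injective n) fun k => (p k + q k) univ)
    exact le_add_self⟩
  have hsplit : ∀ (r : ℕ → Measure (Config d)) n, Measure.sum (fun k => r (k + n))
      = r n + Measure.sum (fun k => r (k + (n + 1))) := by
    intro r n
    ext s hs
    rw [Measure.add_apply, Measure.sum_apply _ hs, Measure.sum_apply _ hs,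
      tsum_eq_zero_add' ENNReal.summable, zero_add]
    simp only [add_assoc, add_comm 1 n]
  -- The `n`-th tail of the series; `a 0` is its sum.
  let a : ℕ → SignedMeasure (Config d) := fun n =>
    toSigned (Measure.sum fun k => p (k + n)) - toSigned (Measure.sum fun k => q (k + n))
  have ha : ∀ n, a n ∈ MStar d := by
    intro n
    refine le_antisymm ((totalVariation_toSigned_sub_le _ _ _).trans ?_) bot_le
    have h0 : ∀ k, p k (tempered d)ᶜ + q k (tempered d)ᶜ = 0 := fun k => (u k).2
    simp only [add_eq_zero] at h0
    rw [Measure.add_apply, Measure.sum_apply _ measurableSet_tempered.compl,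
      Measure.sum_apply _ measurableSet_tempered.compl]
    simp [fun k => (h0 k).1, fun k => (h0 k).2]
  have hstep : ∀ n, a n = u n + a (n + 1) := by
    intro n
    have e := eq_toSigned_sub (u n).1
    have := hfp (n + 1)
    have := hfq (n + 1)
    have f1 : IsFiniteMeasure (p n) := (u n).1.toJordanDecomposition.posPart_finite
    have f2 : IsFiniteMeasure (q n) := (u n).1.toJordanDecomposition.negPart_finite
    simp only [a]
    rw [hsplit p, hsplit q, toSigned_add, toSigned_add, e]
    abel
  have hrem : ∀ n, (⟨a 0, ha 0⟩ : MStar d) - ∑ i ∈ Finset.range n, u i = ⟨a n, ha n⟩ := by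
    intro n
    induction n with
    | zero => simp
    | succ n ih =>
      rw [Finset.sum_range_succ, ← sub_sub, ih]
      refine Subtype.ext ?_
      rw [Submodule.coe_sub]
      simp only [hstep n]
      abel
  refine ⟨⟨a 0, ha 0⟩, ?_⟩
  rw [tendsto_iff_norm_sub_tendsto_zero]
  have hle : ∀ n, ‖∑ i ∈ Finset.range n, u i - ⟨a 0, ha 0⟩‖
      ≤ (∑' k, (p (k + n) + q (k + n)) univ).toReal := by
    intro n
    rw [norm_sub_rev, hrem, MStar_norm]
    refine ENNReal.toReal_mono ?_ ?_
    · exact ne_top_of_le_ne_top hsum (ENNReal.tsum_comp_le_tsum_of_injective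
        (add_left_injective n) fun k => (p k + q k) univ)
    · refine (totalVariation_toSigned_sub_le _ _ _).trans_eq ?_
      rw [Measure.add_apply, Measure.sum_apply _ MeasurableSet.univ,
        Measure.sum_apply _ MeasurableSet.univ, ← ENNReal.tsum_add]
      rfl
  refine squeeze_zero (fun _ => norm_nonneg _) hle ?_
  exact (ENNReal.tendsto_toReal_zero_iff fun n => ne_top_of_le_ne_top hsum
    (ENNReal.tsum_comp_le_tsum_of_injective (add_left_injective n) fun k => (p k + q k) univ)).2
    (ENNReal.tendsto_sum_nat_add _ hsum)

/-! ### Truncation to sublevel sets of Ψ and density -/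

variable (d) in
/-- The configurations with `Ψ ≤ N + 1`. -/
def sublevel (N : ℕ) : Set (Config d) := {γ | Psi γ ≤ N + 1}

theorem measurableSet_sublevel (N : ℕ) : MeasurableSet (sublevel d N) :=
  measurableSet_le measurable_Psi measurable_const

/-- Dominated convergence: the total variation is carried by tempered configurations, and each of
these lies in all sufficiently high sublevel sets. -/
theorem tendsto_setLIntegral_compl_sublevel {μ : SignedMeasure (Config d)} (hμ : μ ∈ MStar d)
    {w : Config d → ℝ≥0∞} (hw : Measurable w) (h : absIntegral w μ < ∞) :
    Tendsto (fun N => ∫⁻ γ in (sublevel d N)ᶜ, w γ ∂μ.totalVariation) atTop (𝓝 0) := by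
  simp only [← lintegral_indicator (measurableSet_sublevel _).compl]
  rw [← lintegral_zero (μ := μ.totalVariation)]
  refine tendsto_lintegral_of_dominated_convergence w
    (fun N => hw.indicator (measurableSet_sublevel N).compl)
    (fun N => ae_of_all _ fun γ => indicator_le_self _ _ γ) h.ne ?_
  have hae : ∀ᵐ γ ∂μ.totalVariation, γ ∈ tempered d := hμ
  filter_upwards [hae] with γ hγ
  refine tendsto_const_nhds.congr' ?_
  obtain ⟨N, hN⟩ := ENNReal.exists_nat_gt (show Psi γ ≠ ∞ from ne_of_lt hγ)
  filter_upwards [eventually_ge_atTop N] with M hM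
  rw [indicator_of_notMem]
  simp only [sublevel, mem_compl_iff, mem_ofPred_eq, not_not]
  exact hN.le.trans ((Nat.cast_le.2 hM).trans le_self_add)

/-- The restriction of `μ` to the configurations with `Ψ ≤ N + 1`. -/
def truncate (N : ℕ) (μ : SignedMeasure (Config d)) : SignedMeasure (Config d) :=
  signedExt (fun m => m.restrict (sublevel d N)) μ

theorem measurable_weight (n : ℕ) : Measurable fun γ : Config d => (1 + Psi γ) ^ n :=
  (measurable_const.add measurable_Psi).pow_const n

theorem truncate_mem_Mn (N n : ℕ) (μ : SignedMeasure (Config d)) : truncate N μ ∈ Mn d n := by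
  refine (absIntegral_signedExt_restrict_le _ μ _).trans_lt ?_
  refine (setLIntegral_mono (g := fun _ => (1 + (N + 1)) ^ n) measurable_const
    fun γ hγ => ?_).trans_lt ?_
  · gcongr
    exact hγ
  · rw [setLIntegral_const]
    refine ENNReal.mul_lt_top (ENNReal.pow_lt_top ?_) (measure_lt_top _ _)
    exact_mod_cast ENNReal.natCast_lt_top (1 + (N + 1))

theorem tendsto_absIntegral_sub_truncate {μ : SignedMeasure (Config d)} (hμ : μ ∈ MStar d)
    {w : Config d → ℝ≥0∞} (hw : Measurable w) (h : absIntegral w μ < ∞) :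
    Tendsto (fun N => absIntegral w (μ - truncate N μ)) atTop (𝓝 0) := by
  refine tendsto_of_tendsto_of_tendsto_of_le_of_le tendsto_const_nhds
    (tendsto_setLIntegral_compl_sublevel hμ hw h) (fun _ => bot_le) fun N => ?_
  rw [truncate, sub_signedExt_restrict μ (measurableSet_sublevel N)]
  exact absIntegral_signedExt_restrict_le _ μ _

theorem dense_Mn {n : ℕ} (hn : 1 ≤ n) :
    Dense {μ : MStar d | (μ : SignedMeasure (Config d)) ∈ Mn d n} := by
  intro μ
  have h := tendsto_absIntegral_sub_truncate μ.2 measurable_const (MStar_finite μ.1)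
  refine mem_closure_of_tendsto (b := atTop) (f := fun N =>
    (⟨truncate N μ.1, Mn_le_MStar hn (truncate_mem_Mn N n μ.1)⟩ : MStar d)) ?_
    (Eventually.of_forall fun N => truncate_mem_Mn N n μ.1)
  rw [tendsto_iff_norm_sub_tendsto_zero]
  simp only [norm_sub_rev _ μ]
  exact (ENNReal.tendsto_toReal_zero_iff fun N => (MStar_finite _).ne).2 h

theorem dense_Mn_succ (n : ℕ) (hn : 1 ≤ n) :
    Dense {μ : Mn d n | (μ : SignedMeasure (Config d)) ∈ Mn d (n + 1)} := by
  intro μ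
  have h := tendsto_absIntegral_sub_truncate (Mn_le_MStar hn μ.2) (measurable_weight n) μ.2
  refine mem_closure_of_tendsto (b := atTop) (f := fun N =>
    (⟨truncate N μ.1, truncate_mem_Mn N n μ.1⟩ : Mn d n)) ?_
    (Eventually.of_forall fun N => truncate_mem_Mn N (n + 1) μ.1)
  rw [tendsto_iff_norm_sub_tendsto_zero]
  simp only [norm_sub_rev _ μ]
  exact (ENNReal.tendsto_toReal_zero_iff fun N =>
    ((Mn d n).sub_mem μ.2 (truncate_mem_Mn N n μ.1)).ne).2 h

/-- Removing a point cannot raise Ψ, and the new point adds at most 1. The weight estimates use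
nothing else about where the point lands. -/
theorem Psi_jump_le (γ : Config d) (x y : Habitat d) : Psi (γ.jump x y) ≤ Psi γ + 1 := by
  classical
  rw [Psi, Config.jump, Config.sum_add]
  refine add_le_add ?_ ?_
  · rw [Psi, ← Config.sum_remove γ x]
    exact le_self_add
  · refine ENNReal.ofReal_le_one.2 ?_
    have : 0 ≤ ‖y‖ ^ (d + 1) := by positivity
    unfold psi
    rw [one_mul]
    exact div_le_one_of_le₀ (by linarith) (by linarith)

theorem lintegral_Omega_le {a φ : Habitat d → ℝ} (h : ModelAssumptions a φ) (α : ℝ)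
    {W : ℝ≥0∞ → ℝ≥0∞} (hW : Monotone W) (γ : Config d) :
    ∫⁻ η, W (Psi η) ∂(Omega a φ α γ) ≤ Phi a φ α γ * W (Psi γ + 1) := by
  have hm : MeasurableSet {η : Config d | Psi η ≤ Psi γ + 1} :=
    measurableSet_le measurable_Psi measurable_const
  have hae : ∀ᵐ η ∂(Omega a φ α γ), Psi η ≤ Psi γ + 1 := by
    change Omega a φ α γ {η : Config d | Psi η ≤ Psi γ + 1}ᶜ = 0
    rw [Omega_apply h α γ hm.compl]
    simp [Config.sum, Psi_jump_le]
  calc ∫⁻ η, W (Psi η) ∂(Omega a φ α γ)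
      ≤ ∫⁻ _, W (Psi γ + 1) ∂(Omega a φ α γ) :=
        lintegral_mono_ae (hae.mono fun η hη => hW hη)
    _ = _ := by rw [lintegral_const, Omega_univ h, mul_comm]

/-! ### The jump chain with bounded rates -/

/-- The time step of the jump chain on the configurations with `Ψ ≤ N + 1`. -/
def stepSize (α : ℝ) (N : ℕ) : ℝ≥0 := α.toNNReal / (N + 1)

theorem stepSize_pos {α : ℝ} (hα : α ∈ Ioc (0 : ℝ) 1) (N : ℕ) : 0 < stepSize α N := by
  have := Real.toNNReal_pos.2 hα.1
  unfold stepSize; positivity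

/-- The probability that the truncated jump chain leaves `γ`. -/
def jumpProb (a φ : Habitat d → ℝ) (α : ℝ) (N : ℕ) (γ : Config d) : ℝ≥0∞ :=
  (sublevel d N).indicator (fun γ => stepSize α N * Phi a φ α γ) γ

theorem measurable_jumpProb {a φ : Habitat d → ℝ} (h : ModelAssumptions a φ) (α : ℝ) (N : ℕ) :
    Measurable (jumpProb a φ α N) :=
  ((measurable_Phi h α).const_mul _).indicator (measurableSet_sublevel N)

/-- Linear growth of the rate. The constant is kept proportional to the time step, so that it
becomes `1 / α` per unit time, whatever `N` is. -/
theorem jumpProb_le {a φ : Habitat d → ℝ} (h : ModelAssumptions a φ) {α : ℝ}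
    (hα : α ∈ Ioc (0 : ℝ) 1) (N : ℕ) (γ : Config d) :
    jumpProb a φ α N γ ≤ ENNReal.ofReal (stepSize α N / α) * Psi γ := by
  refine (indicator_le_self _ _ γ).trans ?_
  refine (mul_le_mul_right (Phi_le h hα γ) _).trans_eq ?_
  rw [← mul_assoc, div_eq_mul_inv, ENNReal.ofReal_mul (NNReal.coe_nonneg _),
    ENNReal.ofReal_coe_nnreal]

theorem stepSize_div {α : ℝ} (hα : α ∈ Ioc (0 : ℝ) 1) (N : ℕ) :
    (stepSize α N : ℝ) / α = ((N : ℝ) + 1)⁻¹ := by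
  have := hα.1.ne'
  rw [stepSize]
  push_cast
  rw [Real.coe_toNNReal _ hα.1.le]
  field_simp

/-- This dictates the time step: on the sublevel set the rate is at most `(N + 1) / α`, the
reciprocal of `stepSize α N`. -/
theorem jumpProb_le_one {a φ : Habitat d → ℝ} (h : ModelAssumptions a φ) {α : ℝ}
    (hα : α ∈ Ioc (0 : ℝ) 1) (N : ℕ) (γ : Config d) : jumpProb a φ α N γ ≤ 1 := by
  by_cases hγ : γ ∈ sublevel d N
  · refine (jumpProb_le h hα N γ).trans ?_
    refine (mul_le_mul_right (show Psi γ ≤ N + 1 from hγ) _).trans ?_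
    rw [stepSize_div hα, ENNReal.ofReal_inv_of_pos (by positivity)]
    have : ENNReal.ofReal ((N : ℝ) + 1) = N + 1 := by
      rw [ENNReal.ofReal_add (by positivity) zero_le_one, ENNReal.ofReal_natCast,
        ENNReal.ofReal_one]
    rw [this]
    exact ENNReal.inv_mul_le_one _
  · rw [jumpProb, indicator_of_notMem hγ]
    exact zero_le_one

/-- One step of the jump chain on the configurations with `Ψ ≤ N + 1`. -/
def chain (a φ : Habitat d → ℝ) (α : ℝ) (N : ℕ) (m : Measure (Config d)) : Measure (Config d) :=
  m.withDensity (fun γ => 1 - jumpProb a φ α N γ)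
    + stepSize α N • (m.restrict (sublevel d N)).bind (Omega a φ α)

/-- The action of the jump chain on functions. -/
def chainFun (a φ : Habitat d → ℝ) (α : ℝ) (N : ℕ) (w : Config d → ℝ≥0∞) (γ : Config d) : ℝ≥0∞ :=
  (1 - jumpProb a φ α N γ) * w γ
    + (sublevel d N).indicator (fun γ => stepSize α N * ∫⁻ η, w η ∂(Omega a φ α γ)) γ

theorem measurable_chainFun {a φ : Habitat d → ℝ} (h : ModelAssumptions a φ) (α : ℝ) (N : ℕ)
    {w : Config d → ℝ≥0∞} (hw : Measurable w) : Measurable (chainFun a φ α N w) :=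
  ((measurable_const.sub (measurable_jumpProb h α N)).mul hw).add
    ((((Measure.measurable_lintegral hw).comp (measurable_Omega h α)).const_mul _).indicator
      (measurableSet_sublevel N))

/-- Duality between the chain on measures and on functions: it reduces norm estimates for measures
to pointwise inequalities between weights. -/
theorem lintegral_chain {a φ : Habitat d → ℝ} (h : ModelAssumptions a φ) (α : ℝ) (N : ℕ)
    (m : Measure (Config d)) {w : Config d → ℝ≥0∞} (hw : Measurable w) :
    ∫⁻ γ, w γ ∂(chain a φ α N m) = ∫⁻ γ, chainFun a φ α N w γ ∂m := by
  have h1 : Measurable fun γ => 1 - jumpProb a φ α N γ :=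
    measurable_const.sub (measurable_jumpProb h α N)
  have h2 : Measurable fun γ => ∫⁻ η, w η ∂(Omega a φ α γ) :=
    (Measure.measurable_lintegral hw).comp (measurable_Omega h α)
  simp only [chain, chainFun]
  rw [lintegral_add_measure, lintegral_smul_measure,
    lintegral_withDensity_eq_lintegral_mul _ h1 hw,
    Measure.lintegral_bind (measurable_Omega h α).aemeasurable hw.aemeasurable,
    lintegral_add_left (f := fun γ => (1 - jumpProb a φ α N γ) * w γ) (h1.mul hw),
    lintegral_indicator (measurableSet_sublevel N), lintegral_const_mul _ h2]
  rfl

/-- Mass is conserved because the kernel `Omega` has total mass `Phi`, exactly the rate of leaving.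
-/
theorem chainFun_one {a φ : Habitat d → ℝ} (h : ModelAssumptions a φ) {α : ℝ}
    (hα : α ∈ Ioc (0 : ℝ) 1) (N : ℕ) (γ : Config d) : chainFun a φ α N (fun _ => 1) γ = 1 := by
  simp only [chainFun, lintegral_one, mul_one, Omega_univ h]
  exact tsub_add_cancel_of_le (jumpProb_le_one h hα N γ)

theorem chainFun_le {a φ : Habitat d → ℝ} (h : ModelAssumptions a φ) (α : ℝ) (N : ℕ)
    {W : ℝ≥0∞ → ℝ≥0∞} (hW : Monotone W) (γ : Config d) :
    chainFun a φ α N (fun η => W (Psi η)) γ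
      ≤ (1 - jumpProb a φ α N γ) * W (Psi γ) + jumpProb a φ α N γ * W (Psi γ + 1) := by
  refine add_le_add le_rfl ?_
  by_cases hγ : γ ∈ sublevel d N
  · rw [jumpProb, indicator_of_mem hγ, indicator_of_mem hγ, mul_assoc]
    exact mul_le_mul_right (lintegral_Omega_le h α hW γ) _
  · rw [indicator_of_notMem hγ]
    exact zero_le

theorem chain_univ {a φ : Habitat d → ℝ} (h : ModelAssumptions a φ) {α : ℝ}
    (hα : α ∈ Ioc (0 : ℝ) 1) (N : ℕ) (m : Measure (Config d)) : chain a φ α N m univ = m univ := by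
  rw [← lintegral_one, ← lintegral_one, lintegral_chain h α N m measurable_const]
  exact lintegral_congr fun γ => chainFun_one h hα N γ

theorem isFiniteMeasure_chain {a φ : Habitat d → ℝ} (h : ModelAssumptions a φ) {α : ℝ}
    (hα : α ∈ Ioc (0 : ℝ) 1) (N : ℕ) (m : Measure (Config d)) [IsFiniteMeasure m] :
    IsFiniteMeasure (chain a φ α N m) :=
  ⟨by rw [chain_univ h hα]; exact measure_lt_top m _⟩

theorem bind_add {a φ : Habitat d → ℝ} (h : ModelAssumptions a φ) (α : ℝ)
    (m m' : Measure (Config d)) :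
    (m + m').bind (Omega a φ α) = m.bind (Omega a φ α) + m'.bind (Omega a φ α) := by
  ext s hs
  have hm := measurable_Omega h α
  simp only [Measure.add_apply, Measure.bind_apply hs hm.aemeasurable, lintegral_add_measure]

theorem bind_smul {a φ : Habitat d → ℝ} (h : ModelAssumptions a φ) (α : ℝ) (c : ℝ≥0)
    (m : Measure (Config d)) :
    (c • m).bind (Omega a φ α) = c • m.bind (Omega a φ α) := by
  ext s hs
  have hm := measurable_Omega h α
  simp only [Measure.smul_apply, Measure.bind_apply hs hm.aemeasurable, lintegral_smul_measure]

theorem isPositiveLinearOn_chain {a φ : Habitat d → ℝ} (h : ModelAssumptions a φ) {α : ℝ}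
    (hα : α ∈ Ioc (0 : ℝ) 1) (N : ℕ) : IsPositiveLinearOn (chain a φ α N) (MStar d) where
  add m m' := by
    simp only [chain, withDensity_add_measure, Measure.restrict_add, bind_add h, smul_add]
    abel
  smul c m := by
    have e : (c • m).withDensity (fun γ => 1 - jumpProb a φ α N γ)
        = c • m.withDensity (fun γ => 1 - jumpProb a φ α N γ) := withDensity_smul_measure _ _
    simp only [chain, e, Measure.restrict_smul, bind_smul h, smul_add]
    rw [smul_comm]
  finite μ _ := isFiniteMeasure_chain h hα N _

theorem chain_zero {a φ : Habitat d → ℝ} (h : ModelAssumptions a φ) {α : ℝ}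
    (hα : α ∈ Ioc (0 : ℝ) 1) (N : ℕ) : chain a φ α N 0 = 0 := by
  rw [← Measure.measure_univ_eq_zero, chain_univ h hα]; rfl

theorem chain_compl_tempered {a φ : Habitat d → ℝ} (h : ModelAssumptions a φ) (α : ℝ) (N : ℕ)
    (m : Measure (Config d)) (hm : m (tempered d)ᶜ = 0) : chain a φ α N m (tempered d)ᶜ = 0 := by
  have h1 := withDensity_absolutelyContinuous m (fun γ => 1 - jumpProb a φ α N γ) hm
  have hae : ∀ᵐ γ ∂m.restrict (sublevel d N), Omega a φ α γ (tempered d)ᶜ = 0 := by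
    refine measure_mono_null (t := (tempered d)ᶜ) (fun γ hγ => ?_)
      (Measure.absolutelyContinuous_of_le Measure.restrict_le_self hm)
    exact fun hγ' => hγ (Omega_compl_tempered h α hγ')
  rw [chain, Measure.add_apply, h1, Measure.smul_apply,
    Measure.bind_apply measurableSet_tempered.compl (measurable_Omega h α).aemeasurable,
    lintegral_congr_ae hae, lintegral_zero, smul_zero, add_zero]

theorem absIntegral_signedExt_chain_le {a φ : Habitat d → ℝ} (h : ModelAssumptions a φ) (α : ℝ)
    (N : ℕ) (μ : SignedMeasure (Config d)) {w : Config d → ℝ≥0∞} (hw : Measurable w) :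
    absIntegral w (signedExt (chain a φ α N) μ) ≤ absIntegral (chainFun a φ α N w) μ := by
  refine (absIntegral_signedExt_le w _ μ).trans_eq ?_
  rw [lintegral_chain h α N _ hw, lintegral_chain h α N _ hw, absIntegral_eq_add]

/-! ### The truncated generators -/

/-- The transition operator of the jump chain on the configurations with `Ψ ≤ N + 1`. -/
def chainOp {a φ : Habitat d → ℝ} (h : ModelAssumptions a φ) {α : ℝ} (hα : α ∈ Ioc (0 : ℝ) 1)
    (N : ℕ) : MStar d →L[ℝ] MStar d :=
  LinearMap.mkContinuous
    { toFun := fun μ => ⟨signedExt (chain a φ α N) μ,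
        signedExt_mem (chain_compl_tempered h α N) μ.2⟩
      map_add' := fun μ ν =>
        Subtype.ext ((isPositiveLinearOn_chain h hα N).map_add μ.2 ν.2)
      map_smul' := fun c μ =>
        Subtype.ext ((isPositiveLinearOn_chain h hα N).map_smul c μ.2) } 1 fun μ => by
    rw [one_mul]
    refine MStar_norm_le_of_absIntegral_le (norm_nonneg _) ?_
    rw [MStar_ofReal_norm]
    refine (absIntegral_signedExt_chain_le h α N μ measurable_const).trans_eq ?_
    exact lintegral_congr fun γ => chainFun_one h hα N γ

theorem coe_chainOp {a φ : Habitat d → ℝ} (h : ModelAssumptions a φ) {α : ℝ}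
    (hα : α ∈ Ioc (0 : ℝ) 1) (N : ℕ) (μ : MStar d) :
    (chainOp h hα N μ : SignedMeasure (Config d)) = signedExt (chain a φ α N) μ := rfl

/-- The bounded generator of the jump process on the configurations with `Ψ ≤ N + 1`. -/
def truncGen {a φ : Habitat d → ℝ} (h : ModelAssumptions a φ) {α : ℝ} (hα : α ∈ Ioc (0 : ℝ) 1)
    (N : ℕ) : MStar d →L[ℝ] MStar d := (stepSize α N : ℝ)⁻¹ • (chainOp h hα N - 1)

/-- For `0 ≤ τ ≤ stepSize α N` this is a convex combination of the identity and a Markov operator.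
Contractivity, positivity and the weight bounds for one Euler step are read off from it. -/
theorem one_add_smul_truncGen_apply {a φ : Habitat d → ℝ} (h : ModelAssumptions a φ) {α : ℝ}
    (hα : α ∈ Ioc (0 : ℝ) 1) (N : ℕ) (τ : ℝ) (μ : MStar d) :
    (1 + τ • truncGen h hα N) μ
      = (1 - τ / stepSize α N) • μ + (τ / stepSize α N) • chainOp h hα N μ := by
  simp only [truncGen, add_apply, smul_apply,
    sub_apply, one_apply_eq_self, smul_smul, div_eq_mul_inv]
  module

theorem absIntegral_one_add_smul_truncGen_le {a φ : Habitat d → ℝ} (h : ModelAssumptions a φ)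
    {α : ℝ} (hα : α ∈ Ioc (0 : ℝ) 1) (N : ℕ) {τ : ℝ} (hτ : 0 ≤ τ) (hτ' : τ ≤ stepSize α N)
    {w w' : Config d → ℝ≥0∞} (hw : Measurable w)
    (hle : ∀ γ, ENNReal.ofReal (1 - τ / stepSize α N) * w γ
      + ENNReal.ofReal (τ / stepSize α N) * chainFun a φ α N w γ ≤ w' γ) (μ : MStar d) :
    absIntegral w ((1 + τ • truncGen h hα N) μ).1 ≤ absIntegral w' μ.1 := by
  have hs : (0 : ℝ) < stepSize α N := stepSize_pos hα N
  have h0 : 0 ≤ τ / stepSize α N := div_nonneg hτ hs.le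
  have h1 : 0 ≤ 1 - τ / stepSize α N := sub_nonneg.2 ((div_le_one hs).2 hτ')
  rw [one_add_smul_truncGen_apply, Submodule.coe_add, Submodule.coe_smul, Submodule.coe_smul,
    coe_chainOp]
  refine (absIntegral_add_le _ _ _).trans ?_
  rw [absIntegral_smul, absIntegral_smul, Real.enorm_of_nonneg h0, Real.enorm_of_nonneg h1]
  refine (add_le_add le_rfl
    (mul_le_mul_right (absIntegral_signedExt_chain_le h α N μ.1 hw) _)).trans ?_
  rw [← absIntegral_const_mul hw, ← absIntegral_const_mul (measurable_chainFun h α N hw)]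
  simp only [absIntegral]
  rw [← lintegral_add_left (hw.const_mul _)]
  exact lintegral_mono hle

theorem norm_one_add_smul_truncGen_le {a φ : Habitat d → ℝ} (h : ModelAssumptions a φ)
    {α : ℝ} (hα : α ∈ Ioc (0 : ℝ) 1) (N : ℕ) (τ : ℝ) (hτ : 0 ≤ τ) (hτ' : τ ≤ stepSize α N) :
    ‖1 + τ • truncGen h hα N‖ ≤ 1 := by
  have hs : (0 : ℝ) < stepSize α N := stepSize_pos hα N
  have h0 : 0 ≤ τ / stepSize α N := div_nonneg hτ hs.le
  have h1 : 0 ≤ 1 - τ / stepSize α N := sub_nonneg.2 ((div_le_one hs).2 hτ')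
  refine ContinuousLinearMap.opNorm_le_bound _ zero_le_one fun μ => ?_
  rw [one_mul]
  refine MStar_norm_le_of_absIntegral_le (norm_nonneg _) ?_
  rw [MStar_ofReal_norm]
  refine absIntegral_one_add_smul_truncGen_le h hα N hτ hτ' measurable_const (fun γ => ?_) μ
  rw [chainFun_one h hα, ← add_mul, ← ENNReal.ofReal_add h1 h0]
  simp

theorem chainOp_nonneg {a φ : Habitat d → ℝ} (h : ModelAssumptions a φ) {α : ℝ}
    (hα : α ∈ Ioc (0 : ℝ) 1) (N : ℕ) {μ : MStar d} (hμ : 0 ≤ μ.1) :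
    0 ≤ (chainOp h hα N μ).1 := by
  obtain ⟨m, hm, e⟩ := exists_toSigned_of_nonneg hμ
  rw [coe_chainOp, e, signedExt_toSigned (chain_zero h hα N)]
  exact toSigned_nonneg _

theorem chainOp_univ {a φ : Habitat d → ℝ} (h : ModelAssumptions a φ) {α : ℝ}
    (hα : α ∈ Ioc (0 : ℝ) 1) (N : ℕ) (μ : MStar d) :
    (chainOp h hα N μ).1 univ = μ.1 univ := by
  have hf : ∀ (m : Measure (Config d)) [IsFiniteMeasure m],
      toSigned (chain a φ α N m) univ = toSigned m univ := fun m _ => by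
    have := isFiniteMeasure_chain h hα N m
    rw [toSigned_apply _ MeasurableSet.univ, toSigned_apply _ MeasurableSet.univ, measureReal_def,
      chain_univ h hα]
    rfl
  conv_rhs => rw [eq_toSigned_sub μ.1]
  rw [coe_chainOp, signedExt, sub_apply, sub_apply, hf, hf]

theorem one_add_smul_truncGen_nonneg {a φ : Habitat d → ℝ} (h : ModelAssumptions a φ) {α : ℝ}
    (hα : α ∈ Ioc (0 : ℝ) 1) (N : ℕ) {τ : ℝ} (hτ : 0 ≤ τ) (hτ' : τ ≤ stepSize α N)
    {μ : MStar d} (hμ : 0 ≤ μ.1) : 0 ≤ ((1 + τ • truncGen h hα N) μ).1 := by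
  have hs : (0 : ℝ) < stepSize α N := stepSize_pos hα N
  have h0 : 0 ≤ τ / stepSize α N := div_nonneg hτ hs.le
  have h1 : 0 ≤ 1 - τ / stepSize α N := sub_nonneg.2 ((div_le_one hs).2 hτ')
  rw [one_add_smul_truncGen_apply]
  refine VectorMeasure.le_iff.2 fun s hs => ?_
  have h2 := hμ s hs
  have h3 := chainOp_nonneg h hα N hμ s hs
  exact add_nonneg (mul_nonneg h1 h2) (mul_nonneg h0 h3)

theorem one_add_smul_truncGen_univ {a φ : Habitat d → ℝ} (h : ModelAssumptions a φ) {α : ℝ}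
    (hα : α ∈ Ioc (0 : ℝ) 1) (N : ℕ) (τ : ℝ) (μ : MStar d) :
    ((1 + τ • truncGen h hα N) μ).1 univ = μ.1 univ := by
  rw [one_add_smul_truncGen_apply, Submodule.coe_add, Submodule.coe_smul, Submodule.coe_smul,
    add_apply, smul_apply, smul_apply,
    chainOp_univ h hα]
  simp only [smul_eq_mul]
  ring

/-! ### Convergence of the truncated generators to `Ldag` -/

theorem toSigned_smul (c : ℝ≥0) (m : Measure (Config d)) [IsFiniteMeasure m] :
    toSigned (c • m) = (c : ℝ) • toSigned m := by
  rw [toSigned_eq, toSigned_eq, Measure.toSignedMeasure_smul]; rfl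

/-- The relation between one chain step and the truncated gain and loss terms, written without
subtraction so that it makes sense for positive measures. -/
theorem chain_add_smul_withDensity {a φ : Habitat d → ℝ} (h : ModelAssumptions a φ) {α : ℝ}
    (hα : α ∈ Ioc (0 : ℝ) 1) (N : ℕ) (m : Measure (Config d)) :
    chain a φ α N m + stepSize α N • (m.restrict (sublevel d N)).withDensity (Phi a φ α)
      = m + stepSize α N • (m.restrict (sublevel d N)).bind (Omega a φ α) := by
  have e : stepSize α N • (m.restrict (sublevel d N)).withDensity (Phi a φ α)
      = m.withDensity (jumpProb a φ α N) := by
    have e1 : jumpProb a φ α N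
        = (sublevel d N).indicator ((stepSize α N : ℝ≥0∞) • Phi a φ α) := rfl
    rw [e1, withDensity_indicator (measurableSet_sublevel N),
      withDensity_smul _ (measurable_Phi h α)]
    rfl
  have e2 : m.withDensity (fun γ => 1 - jumpProb a φ α N γ) + m.withDensity (jumpProb a φ α N)
      = m := by
    rw [← withDensity_add_right _ (measurable_jumpProb h α N)]
    have : ((fun γ => 1 - jumpProb a φ α N γ) + jumpProb a φ α N) = 1 := by
      ext γ
      exact tsub_add_cancel_of_le (jumpProb_le_one h hα N γ)
    rw [this, withDensity_one]
  rw [chain, e]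
  nth_rewrite 4 [← e2]
  abel

/-- Inside the sublevel set the truncated generator has the same gain and loss terms as the full
one, so only the jumps starting outside survive in the difference. -/
theorem Ldag_sub_truncGen {a φ : Habitat d → ℝ} (h : ModelAssumptions a φ) {α : ℝ}
    (hα : α ∈ Ioc (0 : ℝ) 1) (N : ℕ) (μ : (Ldag h hα).domain) :
    (Ldag h hα μ - truncGen h hα N μ).1
      = signedExt (fun m => (m.restrict (sublevel d N)ᶜ).bind (Omega a φ α)) μ.1.1
        - signedExt (fun m => (m.restrict (sublevel d N)ᶜ).withDensity (Phi a φ α)) μ.1.1 := by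
  set A := sublevel d N
  have hA : MeasurableSet A := measurableSet_sublevel N
  set κ := stepSize α N
  have hκ : (κ : ℝ) ≠ 0 := (NNReal.coe_pos.2 (stepSize_pos hα N)).ne'
  -- The identity is proved for positive measures and then subtracted over the two Jordan parts;
  -- finiteness of the gain and loss terms is what membership in M_1 provides.
  have key : ∀ m : Measure (Config d), IsFiniteMeasure m →
      IsFiniteMeasure (m.withDensity (Phi a φ α)) → IsFiniteMeasure (m.bind (Omega a φ α)) →
      toSigned (m.bind (Omega a φ α)) - toSigned (m.withDensity (Phi a φ α))
        = (κ : ℝ)⁻¹ • (toSigned (chain a φ α N m) - toSigned m)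
          + (toSigned ((m.restrict Aᶜ).bind (Omega a φ α))
          - toSigned ((m.restrict Aᶜ).withDensity (Phi a φ α))) := by
    intro m hm hm1 hm2
    have e1 : m.withDensity (Phi a φ α) = (m.restrict A).withDensity (Phi a φ α)
        + (m.restrict Aᶜ).withDensity (Phi a φ α) := by
      rw [← withDensity_add_measure, Measure.restrict_add_restrict_compl hA]
    have e2 : m.bind (Omega a φ α) = (m.restrict A).bind (Omega a φ α)
        + (m.restrict Aᶜ).bind (Omega a φ α) := by
      rw [← bind_add h, Measure.restrict_add_restrict_compl hA]
    have f1 : IsFiniteMeasure ((m.restrict A).withDensity (Phi a φ α)) :=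
      isFiniteMeasure_of_le _ (e1 ▸ Measure.le_add_right le_rfl)
    have f2 : IsFiniteMeasure ((m.restrict Aᶜ).withDensity (Phi a φ α)) :=
      isFiniteMeasure_of_le _ (e1 ▸ Measure.le_add_left le_rfl)
    have f3 : IsFiniteMeasure ((m.restrict A).bind (Omega a φ α)) :=
      isFiniteMeasure_of_le _ (e2 ▸ Measure.le_add_right le_rfl)
    have f4 : IsFiniteMeasure ((m.restrict Aᶜ).bind (Omega a φ α)) :=
      isFiniteMeasure_of_le _ (e2 ▸ Measure.le_add_left le_rfl)
    have f5 := isFiniteMeasure_chain h hα N m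
    have e3 := congrArg toSigned (chain_add_smul_withDensity h hα N m)
    rw [toSigned_add, toSigned_add, toSigned_smul, toSigned_smul] at e3
    rw [e1, e2, toSigned_add, toSigned_add]
    have e4 : toSigned (chain a φ α N m) - toSigned m
        = (κ : ℝ) • (toSigned ((m.restrict A).bind (Omega a φ α))
          - toSigned ((m.restrict A).withDensity (Phi a φ α))) := by
      rw [smul_sub, sub_eq_sub_iff_add_eq_add, e3, add_comm]
    rw [e4, inv_smul_smul₀ hκ]
    abel
  have hp := key _ μ.1.1.toJordanDecomposition.posPart_finite
    ((isPositiveLinearOn_withDensity h hα).finite_posPart μ.2)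
    ((isPositiveLinearOn_bind h hα).finite_posPart μ.2)
  have hn := key _ μ.1.1.toJordanDecomposition.negPart_finite
    ((isPositiveLinearOn_withDensity h hα).finite_negPart μ.2)
    ((isPositiveLinearOn_bind h hα).finite_negPart μ.2)
  have hL : (Ldag h hα μ).1 = opA a φ α μ.1.1 + opB a φ α μ.1.1 := rfl
  have hT : (truncGen h hα N μ).1
      = (κ : ℝ)⁻¹ • (signedExt (chain a φ α N) μ.1.1 - μ.1.1) := rfl
  have hμ : (κ : ℝ)⁻¹ • μ.1.1 = (κ : ℝ)⁻¹ • toSigned μ.1.1.toJordanDecomposition.posPart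
      - (κ : ℝ)⁻¹ • toSigned μ.1.1.toJordanDecomposition.negPart := by
    exact (congrArg ((κ : ℝ)⁻¹ • ·) (eq_toSigned_sub μ.1.1)).trans (smul_sub _ _ _)
  rw [Submodule.coe_sub, hL, hT, smul_sub, hμ, opA, opB]
  simp only [signedExt]
  have hpn := congrArg₂ (· - ·) hp hn
  simp only [smul_sub] at hpn ⊢
  rw [← sub_eq_zero] at hpn ⊢
  rw [← hpn]
  abel

/-- The factor 2 counts gain and loss, each of which has the integral of the rate as its mass. -/
theorem absIntegral_one_Ldag_sub_truncGen_le {a φ : Habitat d → ℝ} (h : ModelAssumptions a φ)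
    {α : ℝ} (hα : α ∈ Ioc (0 : ℝ) 1) (N : ℕ) (μ : (Ldag h hα).domain) :
    absIntegral (fun _ => 1) (Ldag h hα μ - truncGen h hα N μ).1
      ≤ 2 * ∫⁻ γ in (sublevel d N)ᶜ, Phi a φ α γ ∂μ.1.1.totalVariation := by
  have hb : ∀ m : Measure (Config d), ∫⁻ _, 1 ∂(m.bind (Omega a φ α)) = ∫⁻ γ, Phi a φ α γ ∂m := by
    intro m
    rw [lintegral_one, Measure.bind_apply MeasurableSet.univ (measurable_Omega h α).aemeasurable]
    simp only [Omega_univ h]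
  have hw : ∀ m : Measure (Config d),
      ∫⁻ _, 1 ∂(m.withDensity (Phi a φ α)) = ∫⁻ γ, Phi a φ α γ ∂m := by
    intro m
    rw [lintegral_one, withDensity_apply _ MeasurableSet.univ, setLIntegral_univ]
  rw [Ldag_sub_truncGen]
  refine (absIntegral_sub_le _ _ _).trans ((add_le_add (absIntegral_signedExt_le _ _ _)
    (absIntegral_signedExt_le _ _ _)).trans_eq ?_)
  rw [hb, hb, hw, hw, ← two_mul, totalVariation_eq_add, Measure.restrict_add,
    lintegral_add_measure]

theorem tendsto_truncGen {a φ : Habitat d → ℝ} (h : ModelAssumptions a φ)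
    {α : ℝ} (hα : α ∈ Ioc (0 : ℝ) 1) (μ : (Ldag h hα).domain) :
    Tendsto (fun N => truncGen h hα N μ) atTop (𝓝 (Ldag h hα μ)) := by
  rw [tendsto_iff_norm_sub_tendsto_zero]
  simp only [norm_sub_rev _ (Ldag h hα μ)]
  refine (ENNReal.tendsto_toReal_zero_iff fun N => (MStar_finite _).ne).2 ?_
  have h1 := ENNReal.Tendsto.const_mul (a := 2) (tendsto_setLIntegral_compl_sublevel μ.1.2
    (measurable_Phi h α) (absIntegral_Phi_lt_top h hα μ.2)) (Or.inr (by simp))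
  rw [mul_zero] at h1
  exact tendsto_of_tendsto_of_tendsto_of_le_of_le tendsto_const_nhds h1 (fun _ => bot_le)
    fun N => absIntegral_one_Ldag_sub_truncGen_le h hα N μ

/-- A Markov-type inequality: where Ψ exceeds `N + 1`, the linear rate is at most `1 / (N + 1)`
times a quadratic weight. One moment beyond M_1 thus buys a convergence rate. -/
theorem absIntegral_one_Ldag_sub_truncGen_le_div {a φ : Habitat d → ℝ} (h : ModelAssumptions a φ)
    {α : ℝ} (hα : α ∈ Ioc (0 : ℝ) 1) (N : ℕ) (μ : (Ldag h hα).domain) :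
    absIntegral (fun _ => 1) (Ldag h hα μ - truncGen h hα N μ).1
      ≤ 2 * ENNReal.ofReal α⁻¹ * (N + 1 : ℝ≥0∞)⁻¹
        * absIntegral (fun γ => (1 + Psi γ) ^ 2) μ.1.1 := by
  refine (absIntegral_one_Ldag_sub_truncGen_le h hα N μ).trans ?_
  rw [mul_assoc, mul_assoc]
  refine mul_le_mul_right ?_ _
  rw [← mul_assoc, ← absIntegral_const_mul (measurable_weight 2), absIntegral,
    ← lintegral_indicator (measurableSet_sublevel N).compl]
  refine lintegral_mono fun γ => ?_
  by_cases hγ : γ ∈ (sublevel d N)ᶜ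
  · rw [indicator_of_mem hγ]
    refine (Phi_le h hα γ).trans ?_
    rw [mul_assoc]
    refine mul_le_mul_right ?_ _
    have h1 : (N + 1 : ℝ≥0∞) ≤ 1 + Psi γ := (le_of_lt (not_le.1 (show ¬ Psi γ ≤ N + 1 from hγ))).trans le_add_self
    have h2 : (N + 1 : ℝ≥0∞) ≠ ∞ := by exact_mod_cast ENNReal.natCast_ne_top (N + 1)
    calc Psi γ = (N + 1 : ℝ≥0∞)⁻¹ * ((N + 1) * Psi γ) := by
          rw [← mul_assoc, ENNReal.inv_mul_cancel (by simp) h2, one_mul]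
      _ ≤ (N + 1 : ℝ≥0∞)⁻¹ * ((1 + Psi γ) * (1 + Psi γ)) := by
          gcongr
          exact le_add_self
      _ = _ := by rw [sq]
  · rw [indicator_of_notMem hγ]
    exact zero_le

/-! ### Bounds for the weights -/

/-- The constant is crude. What matters is that the increment is one power of `x` lower, since the
linear jump rate gives that power back. -/
theorem ENNReal_add_one_pow_succ_le {x : ℝ≥0∞} (hx : 1 ≤ x) (m : ℕ) :
    (x + 1) ^ (m + 1) ≤ x ^ (m + 1) + 3 ^ (m + 1) * x ^ m := by
  induction m with
  | zero =>
    simp only [zero_add, pow_one, pow_zero, mul_one]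
    exact add_le_add le_rfl (by norm_num)
  | succ m ih =>
    have h1 : x ^ m ≤ x ^ (m + 1) := pow_le_pow_right₀ hx (Nat.le_succ m)
    have h2 : (1 : ℝ≥0∞) ≤ 3 ^ (m + 1) := one_le_pow₀ (by norm_num)
    calc (x + 1) ^ (m + 1 + 1) = (x + 1) ^ (m + 1) * (x + 1) := pow_succ _ _
      _ ≤ (x ^ (m + 1) + 3 ^ (m + 1) * x ^ m) * (x + 1) := mul_le_mul_left ih _
      _ = x ^ (m + 1 + 1) + (1 * x ^ (m + 1) + 3 ^ (m + 1) * x ^ (m + 1)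
          + 3 ^ (m + 1) * x ^ m) := by ring
      _ ≤ x ^ (m + 1 + 1) + (3 ^ (m + 1) * x ^ (m + 1) + 3 ^ (m + 1) * x ^ (m + 1)
          + 3 ^ (m + 1) * x ^ (m + 1)) := by gcongr
      _ = _ := by ring

theorem powWeight_step {n : ℕ} (hn : 1 ≤ n) {p c s : ℝ≥0∞} (hp : p ≤ 1) (hps : p ≤ c * s) :
    (1 - p) * (1 + s) ^ n + p * (1 + (s + 1)) ^ n
      ≤ (1 + s) ^ n + c * 3 ^ n * (1 + s) ^ n := by
  obtain ⟨m, rfl⟩ : ∃ m, n = m + 1 := ⟨n - 1, by omega⟩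
  set x := 1 + s
  have hx : 1 ≤ x := le_self_add
  have hpx : p ≤ c * x := hps.trans (mul_le_mul_right le_add_self _)
  rw [← add_assoc]
  calc (1 - p) * x ^ (m + 1) + p * (x + 1) ^ (m + 1)
      ≤ (1 - p) * x ^ (m + 1) + p * (x ^ (m + 1) + 3 ^ (m + 1) * x ^ m) := by
        gcongr
        exact ENNReal_add_one_pow_succ_le hx m
    _ = (1 - p + p) * x ^ (m + 1) + p * (3 ^ (m + 1) * x ^ m) := by ring
    _ ≤ 1 * x ^ (m + 1) + c * x * (3 ^ (m + 1) * x ^ m) := by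
        rw [tsub_add_cancel_of_le hp]
        gcongr
    _ = _ := by ring

/-- The weight `e^{b s}`. -/
def expWeight (b : ℝ) (s : ℝ≥0∞) : ℝ≥0∞ := EReal.exp ((ENNReal.ofReal b * s : ℝ≥0∞) : EReal)

theorem expWeight_mono {b b' : ℝ} (hb : b ≤ b') {s s' : ℝ≥0∞} (hs : s ≤ s') :
    expWeight b s ≤ expWeight b' s' := by
  unfold expWeight
  rw [EReal.exp_le_exp_iff, EReal.coe_ennreal_le_coe_ennreal_iff]
  exact mul_le_mul' (ENNReal.ofReal_le_ofReal hb) hs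

theorem expWeight_top {b : ℝ} (hb : 0 < b) : expWeight b ∞ = ∞ := by
  rw [expWeight, ENNReal.mul_top (by simpa using hb)]
  simp

theorem expWeight_ofReal {b r : ℝ} (hb : 0 ≤ b) (hr : 0 ≤ r) :
    expWeight b (ENNReal.ofReal r) = ENNReal.ofReal (Real.exp (b * r)) := by
  rw [expWeight, ← ENNReal.ofReal_mul hb, EReal.coe_ennreal_ofReal,
    max_eq_left (mul_nonneg hb hr), EReal.exp_coe]

theorem measurable_expWeight (b : ℝ) : Measurable fun γ : Config d => expWeight b (Psi γ) :=
  EReal.measurable_exp.comp (measurable_Psi.const_mul (ENNReal.ofReal b)).coe_ereal_ennreal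

/-- A jump multiplies the weight by `e^b`, so the mean factor is at most `1 + θ p (e^b - 1)`, and
`p` grows linearly in `s`. No constant factor can absorb this, but a larger exponent does, through
`1 + u ≤ e^u`. -/
theorem expWeight_step {b θ c : ℝ} (hb : 0 < b) (hθ : 0 ≤ θ) (hθ' : 0 ≤ 1 - θ) (hc : 0 ≤ c)
    {p s : ℝ≥0∞} (hp : p ≤ 1) (hps : p ≤ ENNReal.ofReal c * s) :
    ENNReal.ofReal (1 - θ) * expWeight b s
      + ENNReal.ofReal θ * ((1 - p) * expWeight b s + p * expWeight b (s + 1))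
      ≤ expWeight (b + θ * c * Real.exp b) s := by
  have hb' : 0 < b + θ * c * Real.exp b := by positivity
  -- For infinite `s` the right side is infinite because its exponent is positive.
  rcases eq_or_ne s ∞ with rfl | hs
  · rw [expWeight_top hb']
    exact le_top
  obtain ⟨r, hr, rfl⟩ : ∃ r : ℝ, 0 ≤ r ∧ s = ENNReal.ofReal r :=
    ⟨s.toReal, ENNReal.toReal_nonneg, (ENNReal.ofReal_toReal hs).symm⟩
  obtain ⟨q, hq, rfl⟩ : ∃ q : ℝ, 0 ≤ q ∧ p = ENNReal.ofReal q :=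
    ⟨p.toReal, ENNReal.toReal_nonneg,
      (ENNReal.ofReal_toReal (ne_top_of_le_ne_top ENNReal.one_ne_top hp)).symm⟩
  have hq1 : q ≤ 1 := ENNReal.ofReal_le_one.1 hp
  rw [← ENNReal.ofReal_mul hc, ENNReal.ofReal_le_ofReal_iff (by positivity)] at hps
  have e1 : (1 : ℝ≥0∞) - ENNReal.ofReal q = ENNReal.ofReal (1 - q) := by
    rw [ENNReal.ofReal_sub _ hq, ENNReal.ofReal_one]
  have e2 : ENNReal.ofReal r + 1 = ENNReal.ofReal (r + 1) := by
    rw [ENNReal.ofReal_add hr zero_le_one, ENNReal.ofReal_one]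
  have hq1' : 0 ≤ 1 - q := sub_nonneg.2 hq1
  rw [e1, e2, expWeight_ofReal hb.le hr, expWeight_ofReal hb.le (by positivity),
    expWeight_ofReal hb'.le hr, ← ENNReal.ofReal_mul hq1', ← ENNReal.ofReal_mul hq,
    ← ENNReal.ofReal_add (by positivity) (by positivity), ← ENNReal.ofReal_mul hθ,
    ← ENNReal.ofReal_mul hθ', ← ENNReal.ofReal_add (by positivity) (by positivity)]
  refine ENNReal.ofReal_le_ofReal ?_
  have hE : Real.exp (b * (r + 1)) = Real.exp (b * r) * Real.exp b := by
    rw [← Real.exp_add]; ring_nf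
  have hF : Real.exp ((b + θ * c * Real.exp b) * r)
      = Real.exp (b * r) * Real.exp (θ * (c * r) * Real.exp b) := by
    rw [← Real.exp_add]; ring_nf
  have h1 : 1 + θ * q * (Real.exp b - 1) ≤ Real.exp (θ * (c * r) * Real.exp b) := by
    have h2 : θ * q * (Real.exp b - 1) ≤ θ * (c * r) * Real.exp b := by
      have h3 : θ * q ≤ θ * (c * r) := mul_le_mul_of_nonneg_left hps hθ
      have h4 := mul_le_mul_of_nonneg_right h3 (Real.exp_pos b).le
      have h5 : 0 ≤ θ * q := mul_nonneg hθ hq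
      linarith
    linarith [Real.add_one_le_exp (θ * (c * r) * Real.exp b)]
  rw [hE, hF]
  have h6 := mul_le_mul_of_nonneg_left h1 (Real.exp_pos (b * r)).le
  linarith

/-! ### Truncated semigroups -/

section Truncated

variable {a φ : Habitat d → ℝ} (h : ModelAssumptions a φ) {α : ℝ} (hα : α ∈ Ioc (0 : ℝ) 1)

/-- The semigroup of the jump process on the configurations with `Ψ ≤ N + 1`. -/
def truncSemigroup (N : ℕ) : C0Semigroup (MStar d) := C0Semigroup.ofBounded (truncGen h hα N)

theorem isContraction_truncSemigroup (N : ℕ) : (truncSemigroup h hα N).IsContraction :=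
  C0Semigroup.isContraction_ofBounded (NNReal.coe_pos.2 (stepSize_pos hα N))
    (norm_one_add_smul_truncGen_le h hα N)

theorem tendsto_euler (N : ℕ) (t : ℝ≥0) (μ : MStar d) :
    Tendsto (fun k : ℕ => ((1 + ((t / ((k : ℝ≥0) + 1) : ℝ≥0) : ℝ) • truncGen h hα N) ^ (k + 1)) μ)
      atTop (𝓝 ((truncSemigroup h hα N).op t μ)) :=
  ((ContinuousLinearMap.apply ℝ (MStar d) μ).continuous.tendsto _).comp
    (C0Semigroup.tendsto_one_add_smul_pow (NNReal.coe_pos.2 (stepSize_pos hα N))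
      (norm_one_add_smul_truncGen_le h hα N) t)

theorem eventually_div_le_stepSize {α : ℝ} (hα : α ∈ Ioc (0 : ℝ) 1) (N : ℕ) (t : ℝ≥0) :
    ∀ᶠ k : ℕ in atTop, ((t / ((k : ℝ≥0) + 1) : ℝ≥0) : ℝ) ≤ stepSize α N := by
  have hh0 : Tendsto (fun k : ℕ => ((t / ((k : ℝ≥0) + 1) : ℝ≥0) : ℝ)) atTop (𝓝 0) := by
    have := (tendsto_one_div_add_atTop_nhds_zero_nat (𝕜 := ℝ)).const_mul (t : ℝ)
    simpa [div_eq_mul_inv] using this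
  exact hh0.eventually_le_const (NNReal.coe_pos.2 (stepSize_pos hα N))

theorem truncSemigroup_nonneg (N : ℕ) (t : ℝ≥0) {μ : MStar d} (hμ : 0 ≤ μ.1) :
    0 ≤ ((truncSemigroup h hα N).op t μ).1 := by
  refine MStar_nonneg_of_tendsto (tendsto_euler h hα N t μ) ?_
  filter_upwards [eventually_div_le_stepSize hα N t] with k hk
  generalize k + 1 = j
  induction j with
  | zero => simpa using hμ
  | succ j ih =>
    rw [pow_succ']
    exact one_add_smul_truncGen_nonneg h hα N (NNReal.coe_nonneg _) hk ih

theorem truncSemigroup_univ (N : ℕ) (t : ℝ≥0) (μ : MStar d) :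
    ((truncSemigroup h hα N).op t μ).1 univ = μ.1 univ := by
  refine tendsto_nhds_unique (MStar_tendsto_apply (tendsto_euler h hα N t μ) univ) ?_
  refine tendsto_const_nhds.congr fun k => ?_
  generalize k + 1 = j
  induction j with
  | zero => simp
  | succ j ih =>
    rw [pow_succ', ih]
    exact (one_add_smul_truncGen_univ h hα N _ _).symm

/-- The step size cancels: a chain step has weight `τ / stepSize` and jump probability at most
`stepSize / α` times Ψ. This makes the bound uniform in `N`. -/
theorem absIntegral_pow_one_add_smul_truncGen_le (N : ℕ) {n : ℕ} (hn : 1 ≤ n) {τ : ℝ}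
    (hτ : 0 ≤ τ) (hτ' : τ ≤ stepSize α N) (μ : MStar d) :
    absIntegral (fun γ => (1 + Psi γ) ^ n) ((1 + τ • truncGen h hα N) μ).1
      ≤ ENNReal.ofReal (1 + τ * (3 ^ n / α)) * absIntegral (fun γ => (1 + Psi γ) ^ n) μ.1 := by
  have hs : (0 : ℝ) < stepSize α N := stepSize_pos hα N
  have h0 : 0 ≤ τ / stepSize α N := div_nonneg hτ hs.le
  have h1 : 0 ≤ 1 - τ / stepSize α N := sub_nonneg.2 ((div_le_one hs).2 hτ')
  have hα0 := hα.1
  rw [← absIntegral_const_mul (measurable_weight n)]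
  refine absIntegral_one_add_smul_truncGen_le h hα N hτ hτ' (measurable_weight n)
    (fun γ => ?_) μ
  have h2 := (chainFun_le h α N (W := fun s => (1 + s) ^ n)
    (fun s s' hss => by dsimp only; gcongr) γ).trans
    (powWeight_step hn (jumpProb_le_one h hα N γ) (jumpProb_le h hα N γ))
  refine (add_le_add le_rfl (mul_le_mul_right h2 _)).trans_eq ?_
  set w := (1 + Psi γ) ^ n
  have e3 : (3 : ℝ≥0∞) ^ n = ENNReal.ofReal (3 ^ n) := by
    rw [ENNReal.ofReal_pow (by norm_num)]; norm_num
  have e4 : τ * (3 ^ n / α) = τ / stepSize α N * (stepSize α N / α * 3 ^ n) := by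
    field_simp
  rw [ENNReal.ofReal_add zero_le_one (by positivity), e4, ENNReal.ofReal_mul h0,
    ENNReal.ofReal_mul (by positivity), ← e3]
  have e5 : ENNReal.ofReal (1 - τ / stepSize α N) + ENNReal.ofReal (τ / stepSize α N)
      = ENNReal.ofReal 1 := by
    rw [← ENNReal.ofReal_add h1 h0, sub_add_cancel]
  rw [← e5]
  ring

/-- Discrete Gronwall: the one-step factors multiply to at most the exponential, and lower
semicontinuity carries the bound from the Euler products to their limit. -/
theorem truncSemigroup_absIntegral_pow_le (N : ℕ) {n : ℕ} (hn : 1 ≤ n) (t : ℝ≥0) (μ : MStar d) :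
    absIntegral (fun γ => (1 + Psi γ) ^ n) ((truncSemigroup h hα N).op t μ).1
      ≤ ENNReal.ofReal (Real.exp (t * (3 ^ n / α)))
        * absIntegral (fun γ => (1 + Psi γ) ^ n) μ.1 := by
  have hα0 := hα.1
  refine MStar_absIntegral_le_of_tendsto (tendsto_euler h hα N t μ) (measurable_weight n) ?_
  filter_upwards [eventually_div_le_stepSize hα N t] with k hk
  have hkt := congrArg NNReal.toReal (C0Semigroup.natSucc_mul_div t k)
  set τ : ℝ := ((t / ((k : ℝ≥0) + 1) : ℝ≥0) : ℝ) with hτ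
  have hτ0 : 0 ≤ τ := NNReal.coe_nonneg _
  have hC : 0 ≤ 3 ^ n / α := by positivity
  have hpow : ∀ j : ℕ, absIntegral (fun γ => (1 + Psi γ) ^ n)
      (((1 + τ • truncGen h hα N) ^ j) μ).1 ≤ ENNReal.ofReal ((1 + τ * (3 ^ n / α)) ^ j)
        * absIntegral (fun γ => (1 + Psi γ) ^ n) μ.1 := by
    intro j
    induction j with
    | zero => simp
    | succ j ih =>
      rw [pow_succ', pow_succ' (1 + τ * (3 ^ n / α)), ENNReal.ofReal_mul (by positivity), mul_assoc]
      exact (absIntegral_pow_one_add_smul_truncGen_le h hα N hn hτ0 hk _).trans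
        (mul_le_mul_right ih _)
  refine (hpow (k + 1)).trans (mul_le_mul_left (ENNReal.ofReal_le_ofReal ?_) _)
  have h1 : 1 + τ * (3 ^ n / α) ≤ Real.exp (τ * (3 ^ n / α)) := by
    linarith [Real.add_one_le_exp (τ * (3 ^ n / α))]
  refine (pow_le_pow_left₀ (by positivity) h1 (k + 1)).trans_eq ?_
  rw [← Real.exp_nat_mul, ← mul_assoc]
  congr 2

/-- The step itself costs `τ e^b / α` in the exponent. Replacing `e^b` by `e^β + 1` makes the cost
independent of `b` and matches `timeBound`; the 1 is slack. -/
theorem absIntegral_exp_one_add_smul_truncGen_le (N : ℕ) {b β : ℝ} (hb : 0 < b) (hbβ : b ≤ β)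
    {τ : ℝ} (hτ : 0 ≤ τ) (hτ' : τ ≤ stepSize α N) (μ : MStar d) :
    absIntegral (fun γ => expWeight b (Psi γ)) ((1 + τ • truncGen h hα N) μ).1
      ≤ absIntegral (fun γ => expWeight (b + τ * ((Real.exp β + 1) / α)) (Psi γ)) μ.1 := by
  have hs : (0 : ℝ) < stepSize α N := stepSize_pos hα N
  have h0 : 0 ≤ τ / stepSize α N := div_nonneg hτ hs.le
  have h1 : 0 ≤ 1 - τ / stepSize α N := sub_nonneg.2 ((div_le_one hs).2 hτ')
  have hα0 := hα.1
  refine absIntegral_one_add_smul_truncGen_le h hα N hτ hτ' (measurable_expWeight b)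
    (fun γ => ?_) μ
  refine (add_le_add le_rfl (mul_le_mul_right
    (chainFun_le h α N (fun s s' hss => expWeight_mono le_rfl hss) γ) _)).trans ?_
  refine (expWeight_step hb h0 h1 (by positivity) (jumpProb_le_one h hα N γ)
    (jumpProb_le h hα N γ)).trans (expWeight_mono ?_ le_rfl)
  have e : τ / stepSize α N * (stepSize α N / α) * Real.exp b = τ * (Real.exp b / α) := by
    field_simp
  rw [e]
  gcongr
  linarith [Real.exp_le_exp.2 hbβ]

theorem truncSemigroup_absIntegral_exp_le (N : ℕ) {β β' : ℝ} (hβ' : 0 < β') {t : ℝ≥0}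
    (ht : β' + t * ((Real.exp β + 1) / α) ≤ β) (μ : MStar d) :
    absIntegral (fun γ => expWeight β' (Psi γ)) ((truncSemigroup h hα N).op t μ).1
      ≤ absIntegral (fun γ => expWeight β (Psi γ)) μ.1 := by
  have hα0 := hα.1
  refine MStar_absIntegral_le_of_tendsto (tendsto_euler h hα N t μ) (measurable_expWeight _) ?_
  filter_upwards [eventually_div_le_stepSize hα N t] with k hk
  have hkt := congrArg NNReal.toReal (C0Semigroup.natSucc_mul_div t k)
  set τ : ℝ := ((t / ((k : ℝ≥0) + 1) : ℝ≥0) : ℝ) with hτ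
  have hτ0 : 0 ≤ τ := NNReal.coe_nonneg _
  rw [NNReal.coe_mul, NNReal.coe_natCast] at hkt
  rw [← hkt] at ht
  set c := (Real.exp β + 1) / α with hc
  have hc0 : 0 ≤ c := by positivity
  -- The exponent `b` varies in the induction: the outermost Euler step is estimated first and
  -- raises it by `τ * c`. The budget `b + j * τ * c ≤ β` keeps all intermediate exponents below
  -- `β`.
  have hpow : ∀ (j : ℕ) (b : ℝ), 0 < b → b + j * τ * c ≤ β →
      absIntegral (fun γ => expWeight b (Psi γ)) (((1 + τ • truncGen h hα N) ^ j) μ).1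
        ≤ absIntegral (fun γ => expWeight (b + j * τ * c) (Psi γ)) μ.1 := by
    intro j
    induction j with
    | zero => intro b _ _; simp
    | succ j ih =>
      intro b hb hbj
      have hτc : 0 ≤ τ * c := by positivity
      have hjτc : 0 ≤ j * τ * c := by positivity
      have e : b + τ * c + j * τ * c = b + ((j + 1 : ℕ) : ℝ) * τ * c := by push_cast; ring
      rw [pow_succ', ← e]
      rw [← e] at hbj
      exact (absIntegral_exp_one_add_smul_truncGen_le h hα N hb (by linarith) hτ0 hk _).trans
        (ih (b + τ * c) (by linarith) hbj)
  exact (hpow (k + 1) β' hβ' ht).trans (absIntegral_mono (fun γ => expWeight_mono ht le_rfl) _)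

end Truncated

/-- Split at `1 + Ψ = K`. It turns continuity in the norm of M_* into continuity in M_n for orbits
that stay bounded in M_{n+1}. -/
theorem absIntegral_pow_le_interpolation (n K : ℕ) (hK : K ≠ 0) (ν : SignedMeasure (Config d)) :
    absIntegral (fun γ => (1 + Psi γ) ^ n) ν ≤ K ^ n * absIntegral (fun _ => 1) ν
      + (K : ℝ≥0∞)⁻¹ * absIntegral (fun γ => (1 + Psi γ) ^ (n + 1)) ν := by
  rw [← absIntegral_const_mul measurable_const, ← absIntegral_const_mul (measurable_weight (n + 1)),
    absIntegral, absIntegral, absIntegral, ← lintegral_add_left measurable_const]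
  refine lintegral_mono fun γ => ?_
  dsimp only
  rcases le_total (1 + Psi γ) K with hle | hle
  · rw [mul_one]
    exact (pow_le_pow_left₀ zero_le hle n).trans le_self_add
  · refine le_trans ?_ le_add_self
    have hK' : (K : ℝ≥0∞) ≠ 0 := by exact_mod_cast hK
    calc (1 + Psi γ) ^ n = (K : ℝ≥0∞)⁻¹ * ((1 + Psi γ) ^ n * K) := by
          rw [mul_comm ((1 + Psi γ) ^ n), ← mul_assoc,
            ENNReal.inv_mul_cancel hK' (ENNReal.natCast_ne_top K), one_mul]
      _ ≤ _ := by
          rw [pow_succ]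
          gcongr

/-! ### The limit semigroup and its properties -/

section Limit

variable {a φ : Habitat d → ℝ} (h : ModelAssumptions a φ) {α : ℝ} (hα : α ∈ Ioc (0 : ℝ) 1)

theorem norm_truncGen_sub_le (N M : ℕ) (μ : (Ldag h hα).domain) {R : ℝ} (hR : 0 ≤ R)
    (hμ : absIntegral (fun γ => (1 + Psi γ) ^ 2) μ.1.1 ≤ ENNReal.ofReal R) :
    ‖truncGen h hα N μ - truncGen h hα M μ‖
      ≤ 2 * α⁻¹ * R * (((N : ℝ) + 1)⁻¹ + ((M : ℝ) + 1)⁻¹) := by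
  have hα0 := hα.1
  have key : ∀ N : ℕ, ‖Ldag h hα μ - truncGen h hα N μ‖ ≤ 2 * α⁻¹ * R * ((N : ℝ) + 1)⁻¹ := by
    intro N
    refine MStar_norm_le_of_absIntegral_le (by positivity)
      ((absIntegral_one_Ldag_sub_truncGen_le_div h hα N μ).trans ?_)
    have e : ENNReal.ofReal ((N : ℝ) + 1) = N + 1 := by
      rw [ENNReal.ofReal_add (by positivity) zero_le_one, ENNReal.ofReal_natCast,
        ENNReal.ofReal_one]
    rw [mul_right_comm (2 * α⁻¹), ENNReal.ofReal_mul (by positivity),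
      ENNReal.ofReal_mul (by positivity), ENNReal.ofReal_mul (by positivity),
      ENNReal.ofReal_inv_of_pos (by positivity : (0 : ℝ) < (N : ℝ) + 1), e, ENNReal.ofReal_ofNat]
    exact mul_le_mul_right hμ _
  have e : truncGen h hα N μ - truncGen h hα M μ
      = (Ldag h hα μ - truncGen h hα M μ) - (Ldag h hα μ - truncGen h hα N μ) := by abel
  rw [e]
  have := key N
  have := key M
  linarith [norm_sub_le (Ldag h hα μ - truncGen h hα M μ) (Ldag h hα μ - truncGen h hα N μ)]

/-- Duhamel's estimate compares two truncations along the orbit of one of them. That orbit stays in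
a fixed ball of M_2 up to time `T`, where the generators differ by O(1/N + 1/M). -/
theorem uniformCauchySeqOn_truncSemigroup {μ : MStar d} (hμ : μ.1 ∈ Mn d 2) (T : ℝ≥0) :
    UniformCauchySeqOn (fun N t => (truncSemigroup h hα N).op t μ) atTop (Iic T) := by
  have hα0 := hα.1
  set R : ℝ := Real.exp (T * (3 ^ 2 / α))
    * (absIntegral (fun γ => (1 + Psi γ) ^ 2) μ.1).toReal with hR
  have hR0 : 0 ≤ R := by positivity
  have hμ12 : ∀ ν : SignedMeasure (Config d), ν ∈ Mn d 2 → ν ∈ Mn d 1 := fun ν hν =>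
    (absIntegral_mono (fun γ => pow_le_pow_right₀ le_self_add one_le_two) ν).trans_lt hν
  have hbd : ∀ N (s : ℝ≥0), s ≤ T →
      absIntegral (fun γ => (1 + Psi γ) ^ 2) ((truncSemigroup h hα N).op s μ).1
        ≤ ENNReal.ofReal R := by
    intro N s hs
    refine (truncSemigroup_absIntegral_pow_le h hα N one_le_two s μ).trans ?_
    rw [hR, ENNReal.ofReal_mul (by positivity), ENNReal.ofReal_toReal (ne_of_lt hμ)]
    refine mul_le_mul_left (ENNReal.ofReal_le_ofReal (Real.exp_le_exp.2 ?_)) _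
    have : (s : ℝ) ≤ T := hs
    gcongr
  have hdist : ∀ (N M : ℕ) (t : ℝ≥0), t ≤ T →
      dist ((truncSemigroup h hα N).op t μ) ((truncSemigroup h hα M).op t μ)
        ≤ 2 * α⁻¹ * R * T * (((N : ℝ) + 1)⁻¹ + ((M : ℝ) + 1)⁻¹) := by
    intro N M t ht
    rw [dist_eq_norm]
    have htT : (t : ℝ) ≤ T := ht
    refine (C0Semigroup.norm_ofBounded_sub_le (isContraction_truncSemigroup h hα M)
      (C := 2 * α⁻¹ * R * (((N : ℝ) + 1)⁻¹ + ((M : ℝ) + 1)⁻¹)) fun s hs => ?_).trans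
      ((mul_le_mul_of_nonneg_left htT ?_).trans_eq ?_)
    · have hb := hbd N s (hs.trans ht)
      exact norm_truncGen_sub_le h hα N M ⟨_, hμ12 _ (hb.trans_lt ENNReal.ofReal_lt_top)⟩ hR0 hb
    · positivity
    · ring
  refine Metric.uniformCauchySeqOn_iff.2 fun ε hε => ?_
  have hlim : Tendsto (fun N : ℕ => 2 * α⁻¹ * R * T * ((N : ℝ) + 1)⁻¹) atTop (𝓝 0) := by
    simpa [one_div] using (tendsto_one_div_add_atTop_nhds_zero_nat (𝕜 := ℝ)).const_mul
      (2 * α⁻¹ * R * T)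
  obtain ⟨N₀, hN₀⟩ := eventually_atTop.1 (hlim.eventually_lt_const (half_pos hε))
  refine ⟨N₀, fun N hN M hM t ht => (hdist N M t ht).trans_lt ?_⟩
  rw [mul_add]
  linarith [hN₀ N hN, hN₀ M hM]

theorem exists_convergesTo_truncSemigroup :
    ∃ S : C0Semigroup (MStar d), C0Semigroup.ConvergesTo (truncSemigroup h hα) S :=
  C0Semigroup.exists_convergesTo (isContraction_truncSemigroup h hα) (dense_Mn one_le_two)
    fun _ hμ T => uniformCauchySeqOn_truncSemigroup h hα hμ T

theorem limit_absIntegral_pow_le {S : C0Semigroup (MStar d)}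
    (hS : C0Semigroup.ConvergesTo (truncSemigroup h hα) S)
    {n : ℕ} (hn : 1 ≤ n) (t : ℝ≥0) (μ : MStar d) :
    absIntegral (fun γ => (1 + Psi γ) ^ n) (S.op t μ).1
      ≤ ENNReal.ofReal (Real.exp (t * (3 ^ n / α)))
        * absIntegral (fun γ => (1 + Psi γ) ^ n) μ.1 :=
  MStar_absIntegral_le_of_tendsto (hS.tendsto μ t) (measurable_weight n)
    (Eventually.of_forall fun N => truncSemigroup_absIntegral_pow_le h hα N hn t μ)

theorem limit_mem_Mn {S : C0Semigroup (MStar d)}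
    (hS : C0Semigroup.ConvergesTo (truncSemigroup h hα) S)
    {n : ℕ} (hn : 1 ≤ n) (t : ℝ≥0) {μ : MStar d} (hμ : μ.1 ∈ Mn d n) :
    (S.op t μ).1 ∈ Mn d n :=
  (limit_absIntegral_pow_le h hα hS hn t μ).trans_lt (ENNReal.mul_lt_top ENNReal.ofReal_lt_top hμ)

theorem limit_nonneg {S : C0Semigroup (MStar d)}
    (hS : C0Semigroup.ConvergesTo (truncSemigroup h hα) S)
    (t : ℝ≥0) {μ : MStar d} (hμ : 0 ≤ μ.1) : 0 ≤ (S.op t μ).1 :=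
  MStar_nonneg_of_tendsto (hS.tendsto μ t)
    (Eventually.of_forall fun N => truncSemigroup_nonneg h hα N t hμ)

/-- Norm convergence preserves the total mass, so none escapes as the truncation is removed. -/
theorem limit_univ {S : C0Semigroup (MStar d)}
    (hS : C0Semigroup.ConvergesTo (truncSemigroup h hα) S)
    (t : ℝ≥0) (μ : MStar d) : (S.op t μ).1 univ = μ.1 univ :=
  tendsto_nhds_unique (MStar_tendsto_apply (hS.tendsto μ t) univ)
    (tendsto_const_nhds.congr fun N => (truncSemigroup_univ h hα N t μ).symm)

theorem limit_isStochastic {S : C0Semigroup (MStar d)}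
    (hS : C0Semigroup.ConvergesTo (truncSemigroup h hα) S) :
    IsStochastic S := by
  intro t μ hμ
  have h0 := limit_nonneg h hα hS t hμ
  refine ⟨h0, fun h1 => ?_⟩
  rw [MStar_norm_of_nonneg h0, limit_univ h hα hS, ← MStar_norm_of_nonneg hμ, h1]

/-- The domain M_1 is invariant by the first moment bound and dense by truncation; these are the
hypotheses of the core criterion. -/
theorem limit_generator {S : C0Semigroup (MStar d)}
    (hS : C0Semigroup.ConvergesTo (truncSemigroup h hα) S) :
    (Ldag h hα).IsClosable ∧ S.generator = (Ldag h hα).closure := by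
  refine (hS.isContraction (isContraction_truncSemigroup h hα)).generator_eq_closure
    (dense_Mn le_rfl) (fun t μ hμ => limit_mem_Mn h hα hS le_rfl t hμ) fun μ => ?_
  exact hS.tendsto_quot (isContraction_truncSemigroup h hα)
    (fun N => C0Semigroup.tendsto_quot_ofBounded (truncGen h hα N) μ) (tendsto_truncGen h hα μ)

theorem limit_mem_Mbeta {S : C0Semigroup (MStar d)}
    (hS : C0Semigroup.ConvergesTo (truncSemigroup h hα) S)
    {β β' : ℝ} (hβ' : 0 < β') {t : ℝ≥0} (ht : (t : ℝ) < timeBound α β β')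
    {μ : MStar d} (hμ : μ.1 ∈ Mbeta d β) : (S.op t μ).1 ∈ Mbeta d β' := by
  have hα0 := hα.1
  have hle : β' + t * ((Real.exp β + 1) / α) ≤ β := by
    rw [timeBound, lt_div_iff₀ (by positivity)] at ht
    have : t * ((Real.exp β + 1) / α) ≤ β - β' := by
      rw [mul_div_assoc', div_le_iff₀ hα0]
      linarith
    linarith
  refine lt_of_le_of_lt ?_ (show absIntegral (fun γ => expWeight β (Psi γ)) μ.1 < ∞ from hμ)
  exact MStar_absIntegral_le_of_tendsto (hS.tendsto μ t) (measurable_expWeight β')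
    (Eventually.of_forall fun N => truncSemigroup_absIntegral_exp_le h hα N hβ' hle μ)

/-- The operators of the limit semigroup on `M_n`. -/
def limitMnOp {S : C0Semigroup (MStar d)}
    (hS : C0Semigroup.ConvergesTo (truncSemigroup h hα) S)
    {n : ℕ} (hn : 1 ≤ n) (t : ℝ≥0) : Mn d n →L[ℝ] Mn d n :=
  LinearMap.mkContinuous
    { toFun := fun μ => ⟨(S.op t (inclMn hn μ)).1, limit_mem_Mn h hα hS hn t μ.2⟩
      map_add' := fun μ ν => by
        have e := congrArg Subtype.val ((S.op t).map_add (inclMn hn μ) (inclMn hn ν))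
        exact Subtype.ext e
      map_smul' := fun c μ => by
        have e := congrArg Subtype.val ((S.op t).map_smul c (inclMn hn μ))
        exact Subtype.ext e }
    (Real.exp (t * (3 ^ n / α))) fun μ => by
    refine (ENNReal.ofReal_le_ofReal_iff (by positivity)).1 ?_
    rw [ENNReal.ofReal_mul (by positivity), Mn_ofReal_norm, Mn_ofReal_norm]
    exact limit_absIntegral_pow_le h hα hS hn t (inclMn hn μ)

theorem coe_limitMnOp {S : C0Semigroup (MStar d)}
    (hS : C0Semigroup.ConvergesTo (truncSemigroup h hα) S)
    {n : ℕ} (hn : 1 ≤ n) (t : ℝ≥0) (μ : Mn d n) :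
    inclMn hn (limitMnOp h hα hS hn t μ) = S.op t (inclMn hn μ) := rfl

theorem norm_limitMnOp_le {S : C0Semigroup (MStar d)}
    (hS : C0Semigroup.ConvergesTo (truncSemigroup h hα) S)
    {n : ℕ} (hn : 1 ≤ n) (t : ℝ≥0) (μ : Mn d n) :
    ‖limitMnOp h hα hS hn t μ‖ ≤ Real.exp (t * (3 ^ n / α)) * ‖μ‖ :=
  (limitMnOp h hα hS hn t).le_of_opNorm_le
    (LinearMap.mkContinuous_norm_le _ (Real.exp_pos _).le _) μ

/-- With one spare moment, interpolation applies: first `K` is taken large to make the M_{n+1} term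
small uniformly for `t ≤ 1`, and then `t` small for that `K`. -/
theorem tendsto_absIntegral_limit_sub {S : C0Semigroup (MStar d)}
    (hS : C0Semigroup.ConvergesTo (truncSemigroup h hα) S)
    {n : ℕ} {μ : MStar d}
    (hμ : μ.1 ∈ Mn d (n + 1)) :
    Tendsto (fun t => absIntegral (fun γ => (1 + Psi γ) ^ n) (S.op t μ - μ).1) (𝓝 0) (𝓝 0) := by
  have hα0 := hα.1
  set R : ℝ≥0∞ := ENNReal.ofReal (Real.exp (1 * (3 ^ (n + 1) / α)))
    * absIntegral (fun γ => (1 + Psi γ) ^ (n + 1)) μ.1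
    + absIntegral (fun γ => (1 + Psi γ) ^ (n + 1)) μ.1 with hR
  have hRtop : R ≠ ∞ :=
    (ENNReal.add_lt_top.2 ⟨ENNReal.mul_lt_top ENNReal.ofReal_lt_top hμ, hμ⟩).ne
  have hbd : ∀ t ≤ (1 : ℝ≥0),
      absIntegral (fun γ => (1 + Psi γ) ^ (n + 1)) (S.op t μ - μ).1 ≤ R := by
    intro t ht
    refine (absIntegral_sub_le _ _ _).trans (add_le_add ?_ le_rfl)
    refine (limit_absIntegral_pow_le h hα hS (Nat.le_add_left 1 n) t μ).trans ?_
    refine mul_le_mul_left (ENNReal.ofReal_le_ofReal (Real.exp_le_exp.2 ?_)) _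
    have : (t : ℝ) ≤ 1 := ht
    gcongr
  have hnorm : Tendsto (fun t => ENNReal.ofReal ‖S.op t μ - μ‖) (𝓝 0) (𝓝 0) := by
    simpa using ENNReal.tendsto_ofReal (tendsto_iff_norm_sub_tendsto_zero.1 (S.tendsto_zero μ))
  rw [ENNReal.tendsto_nhds_zero]
  intro ε hε
  have hKlim : Tendsto (fun K : ℕ => (K : ℝ≥0∞)⁻¹ * R) atTop (𝓝 0) := by
    simpa using ENNReal.Tendsto.mul_const ENNReal.tendsto_inv_nat_nhds_zero (Or.inr hRtop)
  have hε2 : 0 < ε / 2 := ENNReal.half_pos hε.ne'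
  obtain ⟨K, hK, hK0⟩ := (((ENNReal.tendsto_nhds_zero.1 hKlim) (ε / 2) hε2).and
    (eventually_ne_atTop 0)).exists
  have hlim : Tendsto (fun t => (K : ℝ≥0∞) ^ n * ENNReal.ofReal ‖S.op t μ - μ‖) (𝓝 0) (𝓝 0) := by
    simpa using ENNReal.Tendsto.const_mul (a := (K : ℝ≥0∞) ^ n) hnorm
      (Or.inr (ENNReal.pow_ne_top (ENNReal.natCast_ne_top K)))
  filter_upwards [(ENNReal.tendsto_nhds_zero.1 hlim) (ε / 2) hε2,
    Iic_mem_nhds (zero_lt_one' ℝ≥0)] with t h1 h2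
  rw [MStar_ofReal_norm] at h1
  refine (absIntegral_pow_le_interpolation n K hK0 _).trans ?_
  refine (add_le_add h1 ((mul_le_mul_right (hbd t h2) _).trans hK)).trans_eq ?_
  exact ENNReal.add_halves ε

theorem tendsto_limitMnOp {S : C0Semigroup (MStar d)}
    (hS : C0Semigroup.ConvergesTo (truncSemigroup h hα) S)
    {n : ℕ} (hn : 1 ≤ n) (μ : Mn d n) :
    Tendsto (fun t => limitMnOp h hα hS hn t μ) (𝓝 0) (𝓝 μ) := by
  have hα0 := hα.1
  set G : ℝ := Real.exp (1 * (3 ^ n / α)) with hG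
  have hG0 : 0 < G := Real.exp_pos _
  refine Metric.tendsto_nhds.2 fun ε hε => ?_
  -- The error of replacing `μ` by `ν` enters once through the operator, with factor `G`, and once
  -- directly: `(G + 1) * ‖μ - ν‖ < ε / 2`.
  obtain ⟨ν, hν, hμν⟩ := Metric.mem_closure_iff.1 (dense_Mn_succ n hn μ) (ε / (2 * (G + 1)))
    (by positivity)
  have hν' : Tendsto (fun t => ‖limitMnOp h hα hS hn t ν - ν‖) (𝓝 0) (𝓝 0) :=
    (ENNReal.tendsto_toReal_zero_iff fun t => (limitMnOp h hα hS hn t ν - ν).2.ne).2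
      (tendsto_absIntegral_limit_sub h hα hS (μ := inclMn hn ν) hν)
  filter_upwards [hν'.eventually_lt_const (half_pos hε),
    Iic_mem_nhds (zero_lt_one' ℝ≥0)] with t h1 h2
  have h3 : ‖limitMnOp h hα hS hn t (μ - ν)‖ ≤ G * ‖μ - ν‖ := by
    refine (norm_limitMnOp_le h hα hS hn t _).trans ?_
    have : (t : ℝ) ≤ 1 := h2
    rw [hG]
    gcongr
  rw [dist_eq_norm, lt_div_iff₀ (by positivity)] at hμν
  have e : limitMnOp h hα hS hn t μ - μ = limitMnOp h hα hS hn t (μ - ν)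
      + (limitMnOp h hα hS hn t ν - ν) - (μ - ν) := by
    rw [map_sub]; abel
  rw [dist_eq_norm, e]
  linarith [norm_sub_le (limitMnOp h hα hS hn t (μ - ν) + (limitMnOp h hα hS hn t ν - ν)) (μ - ν),
    norm_add_le (limitMnOp h hα hS hn t (μ - ν)) (limitMnOp h hα hS hn t ν - ν)]

/-- The restriction of the limit semigroup to `M_n`. -/
def limitMn {S : C0Semigroup (MStar d)}
    (hS : C0Semigroup.ConvergesTo (truncSemigroup h hα) S)
    {n : ℕ} (hn : 1 ≤ n) : C0Semigroup (Mn d n) where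
  op := limitMnOp h hα hS hn
  op_zero := by
    ext1 μ
    have e := congrArg Subtype.val (S.op_zero_apply (inclMn hn μ))
    exact Subtype.ext e
  op_add s t := by
    ext1 μ
    have e := congrArg Subtype.val (S.op_add_apply s t (inclMn hn μ))
    exact Subtype.ext e
  tendsto_zero := tendsto_limitMnOp h hα hS hn

end Limit

end Kawasaki

end

open Kawasaki
theorem mainTheorem6 (d : ℕ) (a φ : Habitat d → ℝ) (h : ModelAssumptions a φ) (α : ℝ)
    (hα : α ∈ Ioc (0 : ℝ) 1) :
    (Ldag h hα).IsClosable ∧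
    ∃ S : C0Semigroup (MStar d),
      S.generator = (Ldag h hα).closure ∧
      IsStochastic S ∧
      (∀ (n : ℕ) (hn : 1 ≤ n),
        (∀ (t : ℝ≥0) (μ : MStar d), (μ : SignedMeasure (Config d)) ∈ Mn d n →
          (S.op t μ : SignedMeasure (Config d)) ∈ Mn d n) ∧
        ∃ Sn : C0Semigroup (Mn d n), ∀ (t : ℝ≥0) (μ : Mn d n),
          inclMn hn (Sn.op t μ) = S.op t (inclMn hn μ)) ∧
      (∀ β > 0, ∀ β' ∈ Ioo 0 β, ∀ t : ℝ≥0, (t : ℝ) < timeBound α β β' →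
        ∀ μ : MStar d, (μ : SignedMeasure (Config d)) ∈ Mbeta d β →
          0 ≤ (μ : SignedMeasure (Config d)) →
          (S.op t μ : SignedMeasure (Config d)) ∈ Mbeta d β' ∧
          0 ≤ (S.op t μ : SignedMeasure (Config d))) := by
  obtain ⟨S, hS⟩ := exists_convergesTo_truncSemigroup h hα
  obtain ⟨hcl, hgen⟩ := limit_generator h hα hS
  exact ⟨hcl, S, hgen, limit_isStochastic h hα hS,
    fun n hn => ⟨fun t μ hμ => limit_mem_Mn h hα hS hn t hμ, limitMn h hα hS hn,
      coe_limitMnOp h hα hS hn⟩,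
    fun β _ β' hβ' t ht μ hμ hμ0 =>
      ⟨limit_mem_Mbeta h hα hS hβ'.1 ht hμ, limit_nonneg h hα hS t hμ0⟩⟩
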